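/- \textbf{Conventions.} A groupoid $G$ is identified with its set of arrows; $G^{(0)}\subseteq G$ is its unit space, $r,d:G\to G^{(0)}$ are its range and domain maps, $G^u=r^{-1}(u)$, and $xy$ is defined exactly when $d(x)=r(y)$. A topological groupoid is a groupoid with a topology for which product (on composable pairs) and inverse are continuous; $G^{(0)}$ has the subspace topology. A \emph{system of measures} on a Borel map $\pi:X\to Y$ is a family $\lambda^\bullet=\{\lambda^y\}_{y\in Y}$ of (positive) Borel measures on $X$ such that $\lambda^y$ is concentrated on $\pi^{-1}(y)$. It is \emph{Borel} (a BSM) if $y\mapsto\lambda^y(E)$ is Borel for every Borel $E\subseteq X$; it is \emph{locally bounded} if every $x\in X$ has a neighbourhood $U_x$ and a constant $C_x>0$ with $\lambda^y(U_x)<C_x$ for all $y\in Y$. It is a \emph{disintegration} of a measure $\mu$ on $X$ with respect to a measure $\nu$ on $Y$ if $\mu(E)=\int_Y\lambda^y(E)\,d\nu(y)$ for every Borel $E\subseteq X$. A \emph{continuous left Haar system} for $G$ is a system of measures $\lambda^\bullet$ on $r:G\to G^{(0)}$ such that (i) $u\mapsto\int f\,d\lambda^u$ is a (finite) continuous function on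 $G^{(0)}$ for all $0\le f\in C_c(G)$; (ii) $\lambda^{d(x)}(E)=\lambda^{r(x)}\bigl(x\cdot(E\cap G^{d(x)})\bigr)$ for all $x\in G$ and Borel $E\subseteq G$; (iii) $\lambda^u(A)>0$ for every $u\in G^{(0)}$ and every open $A\subseteq G$ with $A\cap G^u\neq\emptyset$. Given also a measure $\mu^{(0)}$ on $G^{(0)}$, the \emph{induced measure} on $G$ is $\mu(E)=\int_{G^{(0)}}\lambda^u(E)\,d\mu^{(0)}(u)$, and $\mu^{(0)}$ is \emph{quasi-invariant} if $\mu$ and $\mu^{-1}$, $\mu^{-1}(E)=\mu(E^{-1})$, have the same null sets. A \emph{Haar groupoid} $(G,\lambda^\bullet,\mu^{(0)})$ is a locally compact, second countable, Hausdorff topological groupoid $G$ (with its Borel $\sigma$-algebra) with a continuous left Haar system $\lambda^\bullet$ and a non-zero Radon measure $\mu^{(0)}$ on $G^{(0)}$ that is quasi-invariant with respect to $\lambda^\bullet$. A \emph{homomorphism of Haar groupoids} $p:(S,\lambda_S^\bullet,\mu_S^{(0)})\to(G,\lambda_G^\bullet,\mu_G^{(0)})$ is a continuous groupoid homomorphism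 such that $p_*(\mu_S)$ and $\mu_G$ have the same null sets, where $\mu_S,\mu_G$ are the induced measures. \textbf{Setting.} Let $(S,\lambda_S^\bullet,\mu_S^{(0)})$, $(G,\lambda_G^\bullet,\mu_G^{(0)})$, $(T,\lambda_T^\bullet,\mu_T^{(0)})$ be Haar groupoids and let $p:S\to G$, $q:T\to G$ be homomorphisms of Haar groupoids. Let $\gamma_p^\bullet$ and $\gamma_q^\bullet$ be locally bounded BSMs on $p:S^{(0)}\to G^{(0)}$ and $q:T^{(0)}\to G^{(0)}$ which are disintegrations of $\mu_S^{(0)}$, respectively $\mu_T^{(0)}$, with respect to $\mu_G^{(0)}$ (it is assumed that such locally bounded disintegrations exist). The weak pullback is $$P=\{(s,g,t)\in S\times G\times T : r_G(g)=r_G(p(s)),\ d_G(g)=r_G(q(t))\}$$ with the topology induced from $S\times G\times T$, range and domain maps $r_P(s,g,t)=(r_S(s),g,r_T(t))$ and $d_P(s,g,t)=(d_S(s),p(s)^{-1}g\,q(t),d_T(t))$, product $(s,g,t)(\sigma,h,\tau)=(s\sigma,g,t\tau)$ (for $d_P(s,g,t)=r_P(\sigma,h,\tau)$) and inverse $(s,g,t)^{-1}=(s^{-1},p(s)^{-1}g\,q(t),t^{-1})$.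 For $(s,g,t)\in P^{(0)}$ let $\lambda_P^{(s,g,t)}=\lambda_S^s\times\delta_g\times\lambda_T^t$, a measure on $P$; for $x\in G$ let $\eta^x=\gamma_p^{r(x)}\times\delta_x\times\gamma_q^{d(x)}$, a measure on $P^{(0)}\subseteq S^{(0)}\times G\times T^{(0)}$; and for Borel $B\subseteq P^{(0)}$ let $\mu_P^{(0)}(B)=\int_G\eta^x(B)\,d\mu_G(x)$, where $\mu_G$ is the measure on $G$ induced by $\lambda_G^\bullet$ and $\mu_G^{(0)}$. \textbf{Corollary.} $(P,\lambda_P^\bullet,\mu_P^{(0)})$ is a Haar groupoid. -/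

import Mathlib

open MeasureTheory Topology
open scoped NNReal ENNReal

noncomputable section

namespace HaarGpd

/-! ### Groupoids -/

/-- A groupoid on its set of arrows `G`: the unit space is a subset of `G`, the range and domain
maps `r`, `d` are regarded as maps `G → G`, and the product `x y` is defined exactly for the
composable pairs, i.e. those with `d x = r y`. -/
class ArrowGroupoid (G : Type*) where
  r : G → G
  d : G → G
  mul : (x y : G) → d x = r y → G
  inv : G → G
  r_r : ∀ x, r (r x) = r x
  d_r : ∀ x, d (r x) = r x
  r_d : ∀ x, r (d x) = d x
  r_mul : ∀ x y (h : d x = r y), r (mul x y h) = r x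
  d_mul : ∀ x y (h : d x = r y), d (mul x y h) = d y
  assoc : ∀ x y z (h : d x = r y) (k : d y = r z),
    mul (mul x y h) z ((d_mul x y h).trans k) = mul x (mul y z k) (h.trans (r_mul y z k).symm)
  unit_mul : ∀ x, mul (r x) x (d_r x) = x
  mul_unit : ∀ x, mul x (d x) (r_d x).symm = x
  r_inv : ∀ x, r (inv x) = d x
  d_inv : ∀ x, d (inv x) = r x
  mul_inv_eq : ∀ x, mul x (inv x) (r_inv x).symm = r x
  inv_mul_eq : ∀ x, mul (inv x) x (d_inv x) = d x

open ArrowGroupoid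

section Basic

variable {G : Type*} [ArrowGroupoid G]

theorem mul_congr {x x' y y' : G} (hx : x = x') (hy : y = y') (h : d x = r y)
    (h' : d x' = r y') : mul x y h = mul x' y' h' := by
  subst hx; subst hy; rfl

theorem unit_mul' {u x : G} (h : d u = r x) (hu : u = r x) : mul u x h = x := by
  subst hu; exact unit_mul x

theorem mul_unit' {x u : G} (h : d x = r u) (hu : u = d x) : mul x u h = x := by
  subst hu; exact mul_unit x

theorem inv_mul_cancel_left (x y : G) (h : d x = r y) :
    mul (inv x) (mul x y h) ((d_inv x).trans (r_mul x y h).symm) = y := by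
  rw [← assoc (inv x) x y (d_inv x) h]
  exact unit_mul' _ ((inv_mul_eq x).trans h)

theorem mul_inv_cancel_left (x y : G) (h : r x = r y) :
    mul x (mul (inv x) y ((d_inv x).trans h)) ((r_inv x).symm.trans (r_mul _ _ _).symm) = y := by
  rw [← assoc x (inv x) y (r_inv x).symm ((d_inv x).trans h)]
  exact unit_mul' _ ((mul_inv_eq x).trans h)

theorem eq_inv_of_mul (x y : G) (h : d x = r y) (e : mul x y h = r x) : y = inv x := by
  have h1 := inv_mul_cancel_left x y h
  rw [← h1]
  exact mul_unit' _ (e.trans (d_inv x).symm)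

theorem inv_inv (x : G) : inv (inv x) = x :=
  (eq_inv_of_mul (inv x) x (d_inv x) ((inv_mul_eq x).trans (r_inv x).symm)).symm

theorem inv_r (x : G) : inv (r x) = r x :=
  (eq_inv_of_mul (r x) (r x) ((d_r x).trans (r_r x).symm)
    (unit_mul' _ (r_r x).symm |>.trans (r_r x).symm)).symm

theorem inv_mul_rev (x y : G) (h : d x = r y) :
    inv (mul x y h) = mul (inv y) (inv x) ((d_inv y).trans (h.symm.trans (r_inv x).symm)) := by
  symm
  apply eq_inv_of_mul (mul x y h) _ ((d_mul x y h).trans ((r_inv y).symm.trans (r_mul _ _ _).symm))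
  have hk : r y = r (inv x) := h.symm.trans (r_inv x).symm
  rw [assoc x y _ h ((r_inv y).symm.trans (r_mul _ _ _).symm)]
  rw [mul_congr rfl (mul_inv_cancel_left y (inv x) hk) _ (r_inv x).symm, mul_inv_eq, r_mul]

end Basic

/-- The unit space `G⁽⁰⁾`, a subset of `G`. -/
abbrev UnitSpace (G : Type*) [ArrowGroupoid G] : Type _ := {u : G // r u = u}

/-- The range map as a map `G → G⁽⁰⁾`. -/
def rng {G : Type*} [ArrowGroupoid G] (x : G) : UnitSpace G := ⟨r x, r_r x⟩

/-- The domain map as a map `G → G⁽⁰⁾`. -/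
def dom {G : Type*} [ArrowGroupoid G] (x : G) : UnitSpace G := ⟨d x, r_d x⟩

/-- A topological groupoid: the product, on the set of composable pairs with the topology induced
from `G × G`, and the inverse are continuous. -/
class IsTopologicalGroupoid (G : Type*) [TopologicalSpace G] [ArrowGroupoid G] : Prop where
  continuous_mul : Continuous fun z : {z : G × G // d z.1 = r z.2} => mul z.1.1 z.1.2 z.2
  continuous_inv : Continuous (inv : G → G)

/-- Groupoid homomorphisms. -/
structure GpdHom (S G : Type*) [ArrowGroupoid S] [ArrowGroupoid G] where
  toFun : S → G
  map_r : ∀ x, toFun (r x) = r (toFun x)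
  map_d : ∀ x, toFun (d x) = d (toFun x)
  map_mul : ∀ x y (h : d x = r y), toFun (mul x y h) =
    mul (toFun x) (toFun y) ((map_d x).symm.trans ((congrArg toFun h).trans (map_r y)))

instance {S G : Type*} [ArrowGroupoid S] [ArrowGroupoid G] :
    CoeFun (GpdHom S G) (fun _ => S → G) := ⟨GpdHom.toFun⟩

theorem GpdHom.map_inv {S G : Type*} [ArrowGroupoid S] [ArrowGroupoid G] (p : GpdHom S G) (x : S) :
    p (inv x) = inv (p x) := by
  apply eq_inv_of_mul (p x) (p (inv x)) (by rw [← p.map_d, ← p.map_r, r_inv])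
  rw [← p.map_mul x (inv x) (r_inv x).symm, mul_inv_eq, p.map_r]

/-- The restriction `S⁽⁰⁾ → G⁽⁰⁾` of a homomorphism to the unit spaces. -/
def GpdHom.onUnits {S G : Type*} [ArrowGroupoid S] [ArrowGroupoid G] (p : GpdHom S G)
    (u : UnitSpace S) : UnitSpace G :=
  ⟨p u.1, (p.map_r u.1).symm.trans (congrArg p u.2)⟩

/-! ### Systems of measures -/

section Systems

variable {X Y : Type*}

/-- A system of measures on the Borel map `π : X → Y`: a family of measures `lam y` on `X`, with
`lam y` concentrated on `π⁻¹(y)`. -/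
def IsSystemOfMeasures [MeasurableSpace X] [MeasurableSpace Y] (π : X → Y)
    (lam : Y → Measure X) : Prop :=
  Measurable π ∧ ∀ y, lam y (π ⁻¹' {y})ᶜ = 0

/-- Positivity on open sets. -/
def IsPositiveOnOpens [TopologicalSpace X] [MeasurableSpace X] (π : X → Y)
    (lam : Y → Measure X) : Prop :=
  ∀ y, ∀ A : Set X, IsOpen A → (A ∩ π ⁻¹' {y}).Nonempty → 0 < lam y A

/-- A continuous system of measures: a system of measures on a continuous map such that
`y ↦ ∫ f d(lam y)` is a (finite-valued) continuous function for all `0 ≤ f ∈ C_c(X)`. -/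
def IsCSM [TopologicalSpace X] [MeasurableSpace X] [TopologicalSpace Y] [MeasurableSpace Y]
    (π : X → Y) (lam : Y → Measure X) : Prop :=
  IsSystemOfMeasures π lam ∧ Continuous π ∧
    ∀ f : X → ℝ, Continuous f → HasCompactSupport f → (∀ x, 0 ≤ f x) →
      (∀ y, Integrable f (lam y)) ∧ Continuous fun y => ∫ x, f x ∂(lam y)

/-- A Borel system of measures. -/
def IsBSM [MeasurableSpace X] [MeasurableSpace Y] (π : X → Y) (lam : Y → Measure X) : Prop :=
  IsSystemOfMeasures π lam ∧ ∀ E : Set X, MeasurableSet E → Measurable fun y => lam y E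

/-- Local boundedness of a system of measures. -/
def IsLocallyBounded [TopologicalSpace X] [MeasurableSpace X] (lam : Y → Measure X) : Prop :=
  ∀ x : X, ∃ U ∈ 𝓝 x, ∃ C : ℝ≥0, 0 < C ∧ ∀ y, lam y U < C

/-- The system of measures `γ` on `f` is a disintegration of `μ` with respect to `ν`. -/
def IsDisintegration [MeasurableSpace X] [MeasurableSpace Y] (f : X → Y) (γ : Y → Measure X)
    (μ : Measure X) (ν : Measure Y) : Prop :=
  IsSystemOfMeasures f γ ∧ ∀ E : Set X, MeasurableSet E → μ E = ∫⁻ y, γ y E ∂ν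

/-- Equivalence of measures (the same null sets). -/
def MeasureEquiv [MeasurableSpace X] (μ ν : Measure X) : Prop := μ ≪ ν ∧ ν ≪ μ

end Systems

/-! ### Haar groupoids -/

section Haar

variable {G : Type*} [TopologicalSpace G] [MeasurableSpace G] [ArrowGroupoid G]

/-- Left invariance: `λ^{d(x)}(E) = λ^{r(x)}(x · (E ∩ G^{d(x)}))`. -/
def IsLeftInvariant (lam : UnitSpace G → Measure G) : Prop :=
  ∀ x : G, ∀ E : Set G, MeasurableSet E →
    lam (dom x) E = lam (rng x) {z | ∃ y, ∃ h : d x = r y, y ∈ E ∧ z = mul x y h}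

/-- A continuous left Haar system. -/
structure IsHaarSystem (lam : UnitSpace G → Measure G) : Prop where
  csm : IsCSM (rng : G → UnitSpace G) lam
  left_invariant : IsLeftInvariant lam
  positive : IsPositiveOnOpens (rng : G → UnitSpace G) lam

/-- The induced measure `μ(E) = ∫ λ^u(E) dμ⁽⁰⁾(u)` on `G`. (`Measure.bind` is given by this formula
as soon as `u ↦ λ^u(E)` is Borel for all Borel `E`, which holds for every Haar system.) -/
def inducedMeasure (lam : UnitSpace G → Measure G) (mu0 : Measure (UnitSpace G)) : Measure G :=
  mu0.bind lam

/-- Quasi-invariance: the induced measure is equivalent to its image under inversion. -/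
def IsQuasiInvariant (lam : UnitSpace G → Measure G) (mu0 : Measure (UnitSpace G)) : Prop :=
  MeasureEquiv (inducedMeasure lam mu0) ((inducedMeasure lam mu0).map inv)

/-- `(G, lam, mu0)` is a Haar groupoid. (`Measure.Regular` is Mathlib's notion of a Radon measure:
finite on compact sets, outer regular, and inner regular on open sets.) -/
structure IsHaarGroupoid (lam : UnitSpace G → Measure G) (mu0 : Measure (UnitSpace G)) : Prop where
  topologicalGroupoid : IsTopologicalGroupoid G
  locallyCompact : LocallyCompactSpace G
  secondCountable : SecondCountableTopology G
  hausdorff : T2Space G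
  borel : BorelSpace G
  haarSystem : IsHaarSystem lam
  radon : mu0.Regular
  nonzero : mu0 ≠ 0
  quasiInvariant : IsQuasiInvariant lam mu0

/-- `p` is a homomorphism of Haar groupoids. -/
def IsHaarHom {S : Type*} [TopologicalSpace S] [MeasurableSpace S] [ArrowGroupoid S]
    (lamS : UnitSpace S → Measure S) (muS : Measure (UnitSpace S))
    (lamG : UnitSpace G → Measure G) (muG : Measure (UnitSpace G)) (p : GpdHom S G) : Prop :=
  Continuous p ∧ MeasureEquiv ((inducedMeasure lamS muS).map p) (inducedMeasure lamG muG)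

end Haar

/-! ### The weak pullback -/

section WeakPullback

variable {S G T : Type*} [ArrowGroupoid S] [ArrowGroupoid G] [ArrowGroupoid T]

/-- The underlying set of the weak pullback of `p : S → G ← T : q`. Its topology and σ-algebra are
those induced from `S × G × T`. -/
abbrev WeakPullback (p : GpdHom S G) (q : GpdHom T G) : Type _ :=
  {x : S × G × T // r x.2.1 = r (p x.1) ∧ d x.2.1 = r (q x.2.2)}

variable {p : GpdHom S G} {q : GpdHom T G}

/-- `p(s)⁻¹ g q(t)` -/
def WeakPullback.mid (x : WeakPullback p q) : G :=
  mul (mul (inv (p x.1.1)) x.1.2.1 ((d_inv _).trans x.2.1.symm)) (q x.1.2.2)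
    ((d_mul _ _ _).trans x.2.2)

theorem WeakPullback.r_mid (x : WeakPullback p q) : r x.mid = d (p x.1.1) := by
  unfold WeakPullback.mid
  rw [r_mul, r_mul, r_inv]

theorem WeakPullback.d_mid (x : WeakPullback p q) : d x.mid = d (q x.1.2.2) := by
  unfold WeakPullback.mid
  rw [d_mul]

/-- `r_P(s,g,t) = (r_S(s), g, r_T(t))` -/
def WeakPullback.rP (x : WeakPullback p q) : WeakPullback p q :=
  ⟨(r x.1.1, x.1.2.1, r x.1.2.2), by
    refine ⟨?_, ?_⟩
    · simpa only [p.map_r, r_r] using x.2.1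
    · simpa only [q.map_r, r_r] using x.2.2⟩

/-- `d_P(s,g,t) = (d_S(s), p(s)⁻¹ g q(t), d_T(t))` -/
def WeakPullback.dP (x : WeakPullback p q) : WeakPullback p q :=
  ⟨(d x.1.1, x.mid, d x.1.2.2), by
    refine ⟨?_, ?_⟩
    · simp only [p.map_d, r_d, x.r_mid]
    · simp only [q.map_d, r_d, x.d_mid]⟩

/-- `(s,g,t)⁻¹ = (s⁻¹, p(s)⁻¹ g q(t), t⁻¹)` -/
def WeakPullback.invP (x : WeakPullback p q) : WeakPullback p q :=
  ⟨(inv x.1.1, x.mid, inv x.1.2.2), by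
    refine ⟨?_, ?_⟩
    · simp only [p.map_inv, r_inv, x.r_mid]
    · simp only [q.map_inv, r_inv, x.d_mid]⟩

theorem WeakPullback.composable {x y : WeakPullback p q} (h : x.dP = y.rP) :
    d x.1.1 = r y.1.1 ∧ x.mid = y.1.2.1 ∧ d x.1.2.2 = r y.1.2.2 := by
  have h' := congrArg Subtype.val h
  exact ⟨congrArg Prod.fst h', congrArg (fun z => z.2.1) h', congrArg (fun z => z.2.2) h'⟩

/-- `(s,g,t)(σ,h,τ) = (sσ, g, tτ)` -/
def WeakPullback.mulP (x y : WeakPullback p q) (h : x.dP = y.rP) : WeakPullback p q :=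
  ⟨(mul x.1.1 y.1.1 (WeakPullback.composable h).1, x.1.2.1,
    mul x.1.2.2 y.1.2.2 (WeakPullback.composable h).2.2), by
    refine ⟨?_, ?_⟩
    · simpa only [p.map_mul, r_mul] using x.2.1
    · simpa only [q.map_mul, r_mul] using x.2.2⟩

theorem WeakPullback.ext' {x y : WeakPullback p q} (h1 : x.1.1 = y.1.1) (h2 : x.1.2.1 = y.1.2.1)
    (h3 : x.1.2.2 = y.1.2.2) : x = y :=
  Subtype.ext (Prod.ext h1 (Prod.ext h2 h3))

theorem WeakPullback.mid_rP (x : WeakPullback p q) : x.rP.mid = x.1.2.1 := by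
  have hp : inv (p (r x.1.1)) = r (x.1.2.1) := by rw [p.map_r, inv_r, x.2.1]
  have hq : q (r x.1.2.2) = d x.1.2.1 := by rw [q.map_r, x.2.2]
  unfold WeakPullback.mid
  rw [mul_unit']
  · exact unit_mul' _ hp
  · rw [d_mul]; exact hq

theorem WeakPullback.mid_invP (x : WeakPullback p q) : x.invP.mid = x.1.2.1 := by
  have hp : inv (p (inv x.1.1)) = p x.1.1 := by rw [p.map_inv, inv_inv]
  have hq : q (inv x.1.2.2) = inv (q x.1.2.2) := q.map_inv _
  have hA : d (inv (p x.1.1)) = r x.1.2.1 := (d_inv _).trans x.2.1.symm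
  have e1 : d (p x.1.1) = r x.mid := x.r_mid.symm
  have key : mul (p x.1.1) x.mid e1 = mul x.1.2.1 (q x.1.2.2) x.2.2 := by
    have e : x.mid = mul (inv (p x.1.1)) (mul x.1.2.1 (q x.1.2.2) x.2.2)
        (hA.trans (r_mul _ _ _).symm) := assoc _ _ _ hA x.2.2
    rw [mul_congr rfl e e1 ((r_inv _).symm.trans (r_mul _ _ _).symm)]
    exact mul_inv_cancel_left _ _ (x.2.1.symm.trans (r_mul _ _ _).symm)
  have e2 : d (mul (p x.1.1) x.mid e1) = r (inv (q x.1.2.2)) := by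
    rw [d_mul, x.d_mid, r_inv]
  have e3 : d (mul x.1.2.1 (q x.1.2.2) x.2.2) = r (inv (q x.1.2.2)) := by
    rw [d_mul, r_inv]
  calc x.invP.mid = mul (mul (p x.1.1) x.mid e1) (inv (q x.1.2.2)) e2 := by
        unfold WeakPullback.mid
        exact mul_congr (mul_congr hp rfl _ _) hq _ _
    _ = mul (mul x.1.2.1 (q x.1.2.2) x.2.2) (inv (q x.1.2.2)) e3 := mul_congr key rfl _ _
    _ = x.1.2.1 := by
        rw [assoc _ _ _ x.2.2 (r_inv _).symm]
        apply mul_unit'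
        rw [mul_inv_eq, x.2.2]

theorem WeakPullback.mid_mulP (x y : WeakPullback p q) (h : x.dP = y.rP) :
    (WeakPullback.mulP x y h).mid = y.mid := by
  obtain ⟨h1, h2, h3⟩ := WeakPullback.composable h
  have hps : d (p x.1.1) = r (p y.1.1) := by rw [← p.map_d, ← p.map_r, h1]
  have hqt : d (q x.1.2.2) = r (q y.1.2.2) := by rw [← q.map_d, ← q.map_r, h3]
  have hp : inv (p (mul x.1.1 y.1.1 h1)) = mul (inv (p y.1.1)) (inv (p x.1.1))
      ((d_inv _).trans (hps.symm.trans (r_inv _).symm)) := by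
    rw [p.map_mul, inv_mul_rev]
  have hq : q (mul x.1.2.2 y.1.2.2 h3) = mul (q x.1.2.2) (q y.1.2.2) hqt := q.map_mul _ _ _
  have hA : d (inv (p x.1.1)) = r x.1.2.1 := (d_inv _).trans x.2.1.symm
  have hB : d (inv (p y.1.1)) = r (inv (p x.1.1)) :=
    (d_inv _).trans (hps.symm.trans (r_inv _).symm)
  have hC : d (mul (inv (p x.1.1)) x.1.2.1 hA) = r (q x.1.2.2) := (d_mul _ _ _).trans x.2.2
  have hD : d (inv (p y.1.1)) = r (mul (inv (p x.1.1)) x.1.2.1 hA) :=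
    hB.trans (r_mul _ _ _).symm
  have hE : d (inv (p y.1.1)) = r x.mid := by rw [d_inv, x.r_mid, hps]
  have hF : d (mul (mul (inv (p y.1.1)) (inv (p x.1.1)) hB) x.1.2.1 ((d_mul _ _ _).trans hA)) =
      r (mul (q x.1.2.2) (q y.1.2.2) hqt) := by rw [d_mul, r_mul, x.2.2]
  calc (WeakPullback.mulP x y h).mid
      = mul (mul (mul (inv (p y.1.1)) (inv (p x.1.1)) hB) x.1.2.1 ((d_mul _ _ _).trans hA))
          (mul (q x.1.2.2) (q y.1.2.2) hqt) hF := by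
        unfold WeakPullback.mid
        exact mul_congr (mul_congr hp rfl _ _) hq _ _
    _ = mul (mul (inv (p y.1.1)) (mul (inv (p x.1.1)) x.1.2.1 hA) hD)
          (mul (q x.1.2.2) (q y.1.2.2) hqt) (by rw [d_mul, d_mul, r_mul, x.2.2]) :=
        mul_congr (assoc _ _ _ hB hA) rfl _ _
    _ = mul (mul (mul (inv (p y.1.1)) (mul (inv (p x.1.1)) x.1.2.1 hA) hD) (q x.1.2.2)
          ((d_mul _ _ _).trans hC)) (q y.1.2.2) (by rw [d_mul, hqt]) :=
        (assoc _ _ _ ((d_mul _ _ _).trans hC) hqt).symm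
    _ = mul (mul (inv (p y.1.1)) x.mid hE) (q y.1.2.2) (by rw [d_mul, x.d_mid, hqt]) :=
        mul_congr (assoc _ _ _ hD hC) rfl _ _
    _ = y.mid := by
        exact mul_congr (mul_congr rfl h2 _ _) rfl _ _

/-- The groupoid structure of the weak pullback. -/
instance WeakPullback.instArrowGroupoid (p : GpdHom S G) (q : GpdHom T G) :
    ArrowGroupoid (WeakPullback p q) where
  r := WeakPullback.rP
  d := WeakPullback.dP
  mul := WeakPullback.mulP
  inv := WeakPullback.invP
  r_r _ := WeakPullback.ext' (r_r _) rfl (r_r _)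
  d_r x := WeakPullback.ext' (d_r _) x.mid_rP (d_r _)
  r_d _ := WeakPullback.ext' (r_d _) rfl (r_d _)
  r_mul _ _ _ := WeakPullback.ext' (r_mul _ _ _) rfl (r_mul _ _ _)
  d_mul x y h := WeakPullback.ext' (d_mul _ _ _) (WeakPullback.mid_mulP x y h) (d_mul _ _ _)
  assoc _ _ _ h k := WeakPullback.ext'
    (assoc _ _ _ (WeakPullback.composable h).1 (WeakPullback.composable k).1) rfl
    (assoc _ _ _ (WeakPullback.composable h).2.2 (WeakPullback.composable k).2.2)
  unit_mul _ := WeakPullback.ext' (unit_mul _) rfl (unit_mul _)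
  mul_unit _ := WeakPullback.ext' (mul_unit _) rfl (mul_unit _)
  r_inv _ := WeakPullback.ext' (r_inv _) rfl (r_inv _)
  d_inv x := WeakPullback.ext' (d_inv _) x.mid_invP (d_inv _)
  mul_inv_eq _ := WeakPullback.ext' (mul_inv_eq _) rfl (mul_inv_eq _)
  inv_mul_eq _ := WeakPullback.ext' (inv_mul_eq _) rfl (inv_mul_eq _)

/-- The inclusion `P⁽⁰⁾ ⊆ S⁽⁰⁾ × G × T⁽⁰⁾`. -/
def WeakPullback.unitIncl (p : GpdHom S G) (q : GpdHom T G) (u : UnitSpace (WeakPullback p q)) :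
    UnitSpace S × G × UnitSpace T :=
  (⟨u.1.1.1, congrArg (fun z : WeakPullback p q => z.1.1) u.2⟩, u.1.1.2.1,
    ⟨u.1.1.2.2, congrArg (fun z : WeakPullback p q => z.1.2.2) u.2⟩)

variable [MeasurableSpace S] [MeasurableSpace G] [MeasurableSpace T]

/-- The system `λ_P^{(s,g,t)} = λ_S^s × δ_g × λ_T^t`, as measures on `P ⊆ S × G × T`. -/
def WeakPullback.haarSystem (p : GpdHom S G) (q : GpdHom T G)
    (lamS : UnitSpace S → Measure S) (lamT : UnitSpace T → Measure T)
    (u : UnitSpace (WeakPullback p q)) : Measure (WeakPullback p q) :=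
  ((lamS (WeakPullback.unitIncl p q u).1).prod
    ((Measure.dirac (WeakPullback.unitIncl p q u).2.1).prod
      (lamT (WeakPullback.unitIncl p q u).2.2))).comap Subtype.val

/-- The system `η^x = γ_p^{r(x)} × δ_x × γ_q^{d(x)}`, as measures on
`P⁽⁰⁾ ⊆ S⁽⁰⁾ × G × T⁽⁰⁾`. -/
def WeakPullback.eta (p : GpdHom S G) (q : GpdHom T G)
    (γp : UnitSpace G → Measure (UnitSpace S)) (γq : UnitSpace G → Measure (UnitSpace T))
    (x : G) : Measure (UnitSpace (WeakPullback p q)) :=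
  ((γp (rng x)).prod ((Measure.dirac x).prod (γq (dom x)))).comap (WeakPullback.unitIncl p q)

/-- The measure `μ_P⁽⁰⁾(B) = ∫ η^x(B) dμ_G(x)` on `P⁽⁰⁾`, where `μ_G` is the induced measure
of `G`. -/
def WeakPullback.unitMeasure (p : GpdHom S G) (q : GpdHom T G)
    (lamG : UnitSpace G → Measure G) (muG : Measure (UnitSpace G))
    (γp : UnitSpace G → Measure (UnitSpace S)) (γq : UnitSpace G → Measure (UnitSpace T)) :
    Measure (UnitSpace (WeakPullback p q)) :=
  (muG.bind lamG).bind (WeakPullback.eta p q γp γq)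

end WeakPullback

end HaarGpd

end

namespace HaarGpd

open ArrowGroupoid ProbabilityTheory Set Filter

/-! The topological claims hold because $P$ is closed in $S\times G\times T$ and its operations are
assembled from continuous ones. The Haar system is a product of two Haar systems with a Dirac mass.
Its invariance and positivity are therefore checked factor by factor, and its continuity comes from
extending a test function off $P$ and integrating one variable at a time
(`IsCSM.continuous_integral_prod`).

The substance is quasi-invariance. Put $\rho=\lambda_S\circ\gamma_p$ and
$\tau=\lambda_T\circ\gamma_q$, systems of measures over $G^{(0)}$. Viewed on $S\times G\times T$,
the induced measure of $P$ is $M=\int\rho^{r(x)}\times\delta_x\times\tau^{d(x)}\,d\mu_G(x)$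
(`map_val_inducedMeasure`). The inverse $(s,g,t)\mapsto(s^{-1},p(s)^{-1}g\,q(t),t^{-1})$ factors
into two kinds of maps, each of which pulls null sets back to null sets. The swap
$(s,g,t)\mapsto(t,g^{-1},s)$ exchanges the roles of $\rho$ and $\tau$ and is non-singular because
$\mu_G$ is quasi-invariant. The translation $(s,g,t)\mapsto(s^{-1},p(s)^{-1}g,t)$ is handled by
choosing $s$ first: since $\gamma_p$ disintegrates $\mu_S^{(0)}$, $M$ also equals an integral over
$s$ against $\mu_S$ and then over $g$ against $\lambda_G^{r(p(s))}$. Left invariance of $\lambda_G$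
absorbs $p(s)^{-1}$, and quasi-invariance of $\mu_S^{(0)}$ absorbs $s\mapsto s^{-1}$. Conjugating
the same translation for $q$ by swaps gives right multiplication by $q(t)$.

Local boundedness enters twice: it makes every system an s-finite kernel, so that Tonelli applies,
and it makes the measure on $P^{(0)}$ locally finite. That measure is non-zero because the
equivalences $p_*\mu_S\sim\mu_G\sim q_*\mu_T$ force almost all fibre measures to be non-zero. -/

theorem exists_continuous_bump {X : Type*} [TopologicalSpace X] [T2Space X]
    [LocallyCompactSpace X] {K : Set X} (hK : IsCompact K) :
    ∃ χ : X → ℝ, Continuous χ ∧ HasCompactSupport χ ∧ (∀ x, 0 ≤ χ x) ∧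
      ∀ x ∈ K, χ x = 1 := by
  obtain ⟨f, h1, -, h3, h4⟩ := exists_continuous_one_zero_of_isCompact hK isClosed_empty
    (disjoint_empty K)
  exact ⟨f, f.continuous, h3, fun x => (h4 x).1, fun x hx => h1 hx⟩

/-! ### Systems of measures: s-finiteness, measurability, continuity with parameters -/

section Systems

variable {X Y : Type*} [TopologicalSpace X] [MeasurableSpace X] [MeasurableSpace Y]

/-- By the Lindelöf property countably many of the bounding neighbourhoods cover `X`. Made disjoint,
they cut the kernel into pieces that are finite because each bound is uniform in the base point. -/
theorem isSFiniteKernel_of_isLocallyBounded [SecondCountableTopology X] [OpensMeasurableSpace X]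
    (κ : Kernel Y X) (h : IsLocallyBounded κ) : IsSFiniteKernel κ := by
  choose U hU C _ hC using h
  obtain ⟨s, hs, hcov⟩ := TopologicalSpace.countable_cover_nhds
    (fun x => interior_mem_nhds.2 (hU x))
  rcases s.eq_empty_or_nonempty with rfl | hne
  · have : IsEmpty X := by
      rw [← univ_eq_empty_iff, ← hcov]; simp
    have : κ = 0 := by ext a E; simp [Set.eq_empty_of_isEmpty E]
    rw [this]; infer_instance
  · obtain ⟨e, rfl⟩ := hs.exists_eq_range hne
    let D : ℕ → Set X := disjointed fun n => interior (U (e n))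
    have hD : ∀ n, MeasurableSet (D n) :=
      fun n => MeasurableSet.disjointed (fun n => isOpen_interior.measurableSet) n
    refine ⟨⟨fun n => κ.restrict (hD n), fun n => ⟨⟨C (e n), ENNReal.coe_lt_top, fun a => ?_⟩⟩, ?_⟩⟩
    · rw [Kernel.restrict_apply, Measure.restrict_apply_univ]
      exact (measure_mono ((disjointed_subset _ n).trans interior_subset)).trans (hC _ a).le
    · ext a E hE
      rw [Kernel.sum_apply' _ _ hE]
      simp only [Kernel.restrict_apply, Measure.restrict_apply hE]
      rw [← measure_iUnion (fun i j hij => ((disjoint_disjointed _ hij).mono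
        inter_subset_right inter_subset_right)) (fun n => hE.inter (hD n)), ← inter_iUnion,
        iUnion_disjointed]
      congr 1
      have : ⋃ n, interior (U (e n)) = univ := by rw [← hcov]; simp
      rw [this, inter_univ]

theorem IsLocallyBounded.isLocallyFiniteMeasure {Z : Type*} {lam : Z → Measure X}
    (h : IsLocallyBounded lam) (z : Z) : IsLocallyFiniteMeasure (lam z) :=
  ⟨fun x => let ⟨U, hU, _, _, hC⟩ := h x; ⟨U, hU, (hC z).trans ENNReal.coe_lt_top⟩⟩

variable [T2Space X] [LocallyCompactSpace X] [TopologicalSpace Y]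

/-- The integral of a bump function dominates the measure of `K`. As a function of `y` it is
continuous, hence bounded on the compact image of the support, and it vanishes off that image
because `lam y` lives on the fibre. So the bound is global in `y`. -/
theorem IsCSM.isLocallyBounded [T2Space Y] {π : X → Y} {lam : Y → Measure X}
    [OpensMeasurableSpace X] (h : IsCSM π lam) : IsLocallyBounded lam := by
  intro x
  obtain ⟨K, hK, hxK⟩ := exists_compact_mem_nhds x
  obtain ⟨χ, hc, hs, h0, h1⟩ := exists_continuous_bump hK
  obtain ⟨hint, hcont⟩ := h.2.2 χ hc hs h0
  obtain ⟨C, hC⟩ := ((hs.isCompact.image h.2.1).bddAbove_image hcont.continuousOn)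
  refine ⟨K, hxK, Real.toNNReal C + 1, by positivity, fun y => ?_⟩
  have hle : lam y K ≤ ENNReal.ofReal (∫ x, χ x ∂lam y) := by
    rw [ofReal_integral_eq_lintegral_ofReal (hint y) (Eventually.of_forall h0)]
    calc lam y K = ∫⁻ x in K, 1 ∂lam y := by simp
      _ = ∫⁻ x in K, ENNReal.ofReal (χ x) ∂lam y := by
          refine setLIntegral_congr_fun hK.measurableSet fun x hx => ?_
          simp [h1 x hx]
      _ ≤ _ := setLIntegral_le_lintegral _ _
  refine hle.trans_lt ?_
  by_cases hy : y ∈ π '' tsupport χ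
  · have := hC (mem_image_of_mem _ hy)
    refine (ENNReal.ofReal_le_ofReal this).trans_lt ?_
    rw [ENNReal.ofReal]
    exact_mod_cast lt_add_one _
  · have : (∫ x, χ x ∂lam y) = 0 := by
      apply integral_eq_zero_of_ae
      have := h.1.2 y
      filter_upwards [compl_mem_ae_iff.2 this] with x hx
      by_contra hne
      rw [compl_compl] at hx
      exact hy ⟨x, subset_tsupport _ hne, hx⟩
    rw [this]; simp

/-- The indicator of a compact set is the pointwise limit of powers of a bump function that equals 1
exactly there, so compact sets have measurable mass. Compact sets form a π-system generating the
Borel sets. Cutting down to a compact exhaustion supplies the finiteness that the π-λ argument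
needs. -/
theorem IsCSM.measurable [SecondCountableTopology X] [BorelSpace X] [T2Space Y]
    [OpensMeasurableSpace Y] {π : X → Y} {lam : Y → Measure X}
    (h : IsCSM π lam) : Measurable lam := by
  have hfin := fun y => h.isLocallyBounded.isLocallyFiniteMeasure y
  have hcomp : ∀ K : Set X, IsCompact K → Measurable fun y => lam y K := by
    intro K hK
    let _ := TopologicalSpace.metrizableSpaceMetric X
    obtain ⟨f, hf1, -, hf3, hf4⟩ := exists_continuous_one_zero_of_isCompact_of_isGδ hK
      hK.isClosed.isGδ isClosed_empty (disjoint_empty K)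
    -- The exponent `n + 1` keeps the value 0 at 0, so the support stays compact.
    have hs : ∀ n : ℕ, HasCompactSupport fun x => f x ^ (n + 1) := fun n => by
      refine hf3.comp_left (g := fun t : ℝ => t ^ (n + 1)) (by simp)
    have hn := fun n : ℕ => h.2.2 (fun x => f x ^ (n + 1)) (by fun_prop) (hs n)
      (fun x => pow_nonneg (hf4 x).1 _)
    have hn0 := h.2.2 f f.continuous hf3 (fun x => (hf4 x).1)
    have hreal : Measurable fun y => (lam y).real K := by
      refine measurable_of_tendsto_metrizable (fun n => (hn n).2.measurable) ?_
      rw [tendsto_pi_nhds]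
      intro y
      rw [← integral_indicator_one hK.measurableSet]
      refine tendsto_integral_of_dominated_convergence f
        (fun n => ((hn n).1 y).aestronglyMeasurable) (hn0.1 y) ?_ ?_
      · refine fun n => Eventually.of_forall fun x => ?_
        rw [Real.norm_of_nonneg (pow_nonneg (hf4 x).1 _)]
        exact pow_le_of_le_one (hf4 x).1 (hf4 x).2 (by simp)
      · refine Eventually.of_forall fun x => ?_
        by_cases hx : x ∈ K
        · have : f x = 1 := by rw [hf1] at hx; exact hx
          simp [hx, this]
        · have : f x ≠ 1 := fun e => hx (by rw [hf1]; exact e)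
          simp only [hx, not_false_eq_true, indicator_of_notMem]
          exact (tendsto_pow_atTop_nhds_zero_of_lt_one (hf4 x).1
            (lt_of_le_of_ne (hf4 x).2 this)).comp (tendsto_add_atTop_nat 1)
    have : (fun y => lam y K) = fun y => ENNReal.ofReal ((lam y).real K) := by
      ext y
      have := hfin y
      rw [ofReal_measureReal hK.measure_lt_top.ne]
    rw [this]
    exact hreal.ennreal_ofReal
  refine Measure.measurable_of_measurable_coe _ fun E hE => ?_
  have hK := fun n => isCompact_compactCovering X n
  have hrest : ∀ n, Measurable fun y => (lam y).restrict (compactCovering X n) := by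
    intro n
    have : ∀ y, IsFiniteMeasure ((lam y).restrict (compactCovering X n)) := fun y => by
      have := hfin y
      exact ⟨by simpa using (hK n).measure_lt_top⟩
    have hgen : borel X = MeasurableSpace.generateFrom {s : Set X | IsCompact s} := by
      apply le_antisymm
      · rw [borel_eq_generateFrom_isClosed]
        refine MeasurableSpace.generateFrom_le fun F hF => ?_
        have : F = ⋃ m, F ∩ compactCovering X m := by
          rw [← inter_iUnion, iUnion_compactCovering, inter_univ]
        rw [this]
        exact MeasurableSet.iUnion fun m => MeasurableSpace.measurableSet_generateFrom
          ((isCompact_compactCovering X m).inter_left hF)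
      · rw [borel_eq_generateFrom_isClosed]
        exact MeasurableSpace.generateFrom_mono fun F hF => IsCompact.isClosed hF
    refine Measurable.measure_of_isPiSystem (S := {s : Set X | IsCompact s})
      ((BorelSpace.measurable_eq (α := X)).trans hgen) ?_ ?_ ?_
    · exact fun s hs t ht _ => hs.inter ht
    · intro s hs
      simp only [Measure.restrict_apply (show IsCompact s from hs).measurableSet]
      exact hcomp _ (hs.inter (hK n))
    · simpa using hcomp _ (hK n)
  have : (fun y => lam y E) = fun y => ⨆ n, (lam y).restrict (compactCovering X n) E := by
    ext y
    simp only [Measure.restrict_apply hE]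
    rw [← Monotone.measure_iUnion, ← inter_iUnion, iUnion_compactCovering, inter_univ]
    exact fun m n hmn => inter_subset_inter_right _ (compactCovering_subset X hmn)
  rw [this]
  exact Measurable.iSup fun n => (Measure.measurable_coe hE).comp (hrest n)

/-- Integration of the first variable against a continuous system of measures preserves
continuity for functions whose support is uniformly compact in that variable. -/
theorem IsCSM.continuous_integral_prod {Z : Type*} [TopologicalSpace Z] {π : X → Y}
    {lam : Y → Measure X} (h : IsCSM π lam) {F : X × Z → ℝ}
    (hF : Continuous F) (h0 : ∀ w, 0 ≤ F w) {K : Set X} (hK : IsCompact K)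
    (hsupp : ∀ x z, x ∉ K → F (x, z) = 0) :
    Continuous fun w : Y × Z => ∫ x, F (x, w.2) ∂lam w.1 := by
  have hsec : ∀ z, (∀ y, Integrable (fun x => F (x, z)) (lam y)) ∧
      Continuous fun y => ∫ x, F (x, z) ∂lam y := fun z =>
    h.2.2 (fun x => F (x, z)) (by fun_prop)
      (HasCompactSupport.intro hK fun x hx => hsupp x z hx) (fun x => h0 _)
  obtain ⟨χ, hχc, hχs, hχ0, hχ1⟩ := exists_continuous_bump hK
  obtain ⟨hχi, hχt⟩ := h.2.2 χ hχc hχs hχ0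
  rw [continuous_iff_continuousAt]
  rintro ⟨y₀, z₀⟩
  rw [ContinuousAt, Metric.tendsto_nhds]
  intro ε hε
  -- The `+ 1` makes the bound strict at `y₀`, so it persists nearby, and keeps `C` positive. `C`
  -- bounds the mass that can be seen on `K`.
  set C := (∫ x, χ x ∂lam y₀) + 1 with hC
  have hCpos : 0 < C := by have := integral_nonneg (μ := lam y₀) (f := χ) hχ0; positivity
  -- The tube lemma over the compact set `K` turns continuity of `F` into closeness uniform in `x`.
  have hunif : ∀ᶠ z in 𝓝 z₀, ∀ x ∈ K, |F (x, z) - F (x, z₀)| < ε / (2 * C) := by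
    have hopen : IsOpen {w : X × Z | |F w - F (w.1, z₀)| < ε / (2 * C)} :=
      isOpen_lt (by fun_prop) continuous_const
    obtain ⟨u, v, hu, hv, hKu, hzv, huv⟩ := generalized_tube_lemma hK
      (isCompact_singleton (x := z₀)) hopen (by
        rintro ⟨x, z⟩ ⟨-, hz⟩
        obtain rfl : z = z₀ := hz
        have : 0 < ε / (2 * C) := by positivity
        simpa using this)
    filter_upwards [hv.mem_nhds (hzv rfl)] with z hz x hx
    exact huv (mk_mem_prod (hKu hx) hz)
  have h1 : ∀ᶠ y in 𝓝 y₀, ∫ x, χ x ∂lam y < C :=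
    hχt.continuousAt.eventually_lt continuousAt_const (by simp [hC])
  have h2 : ∀ᶠ y in 𝓝 y₀, dist (∫ x, F (x, z₀) ∂lam y) (∫ x, F (x, z₀) ∂lam y₀) < ε / 2 :=
    Metric.tendsto_nhds.1 (hsec z₀).2.continuousAt _ (half_pos hε)
  rw [nhds_prod_eq]
  filter_upwards [(h1.and h2).prod_mk hunif] with ⟨y, z⟩ ⟨⟨hy1, hy2⟩, hz⟩
  have h3 : dist (∫ x, F (x, z) ∂lam y) (∫ x, F (x, z₀) ∂lam y) ≤ ε / (2 * C) * C := by
    rw [Real.dist_eq, ← integral_sub ((hsec z).1 y) ((hsec z₀).1 y)]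
    calc |∫ x, (F (x, z) - F (x, z₀)) ∂lam y|
        ≤ ∫ x, |F (x, z) - F (x, z₀)| ∂lam y := abs_integral_le_integral_abs
      _ ≤ ∫ x, ε / (2 * C) * χ x ∂lam y := by
          refine integral_mono (((hsec z).1 y).sub ((hsec z₀).1 y)).abs
            ((hχi y).const_mul _) fun x => ?_
          by_cases hx : x ∈ K
          · simpa [hχ1 x hx] using (hz x hx).le
          · simp only [hsupp x _ hx, sub_self, abs_zero]
            exact mul_nonneg (by positivity) (hχ0 x)
      _ = ε / (2 * C) * ∫ x, χ x ∂lam y := integral_const_mul _ _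
      _ ≤ ε / (2 * C) * C := by gcongr
  have h4 : ε / (2 * C) * C = ε / 2 := by field_simp
  calc dist (∫ x, F (x, z) ∂lam y) (∫ x, F (x, z₀) ∂lam y₀)
      ≤ _ := dist_triangle _ (∫ x, F (x, z₀) ∂lam y) _
    _ < ε / 2 + ε / 2 := by linarith
    _ = ε := add_halves ε

end Systems

instance {G : Type*} [TopologicalSpace G] [MeasurableSpace G] [BorelSpace G] [ArrowGroupoid G] :
    BorelSpace (UnitSpace G) := Subtype.borelSpace {u : G | r u = u}

instance {G : Type*} [TopologicalSpace G] [SecondCountableTopology G] [ArrowGroupoid G] :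
    SecondCountableTopology (UnitSpace G) :=
  TopologicalSpace.Subtype.secondCountableTopology {u : G | r u = u}

/-! ### Topological groupoids and left division -/

section TopologicalGroupoid

variable {G : Type*} [ArrowGroupoid G]

/-- The total function extending left division `(g, x) ↦ g⁻¹ x` from the pairs with the same
range. -/
noncomputable def ldiv (g x : G) : G :=
  open Classical in if h : r g = r x then mul (inv g) x ((d_inv g).trans h) else x

theorem ldiv_of_eq {g x : G} (h : r g = r x) : ldiv g x = mul (inv g) x ((d_inv g).trans h) :=
  dif_pos h

theorem d_ldiv (g x : G) : d (ldiv g x) = d x := by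
  unfold ldiv
  split_ifs
  · exact d_mul _ _ _
  · rfl

section Continuity

variable [TopologicalSpace G] [IsTopologicalGroupoid G] {Z : Type*} [TopologicalSpace Z]

theorem continuous_gmul {f g : Z → G} (hf : Continuous f) (hg : Continuous g)
    (h : ∀ z, d (f z) = r (g z)) : Continuous fun z => mul (f z) (g z) (h z) :=
  (IsTopologicalGroupoid.continuous_mul (G := G)).comp
    (Continuous.subtype_mk (hf.prodMk hg) h)

theorem continuous_inv : Continuous (inv : G → G) := IsTopologicalGroupoid.continuous_inv

theorem continuous_r : Continuous (r : G → G) := by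
  simpa only [id, mul_inv_eq] using
    continuous_gmul continuous_id (continuous_inv (G := G)) fun x => (r_inv x).symm

theorem continuous_d : Continuous (d : G → G) := by
  simpa only [id, inv_mul_eq] using
    continuous_gmul (continuous_inv (G := G)) continuous_id fun x => d_inv x

theorem continuous_rng : Continuous (rng : G → UnitSpace G) := continuous_r.subtype_mk _

theorem continuous_dom : Continuous (dom : G → UnitSpace G) := continuous_d.subtype_mk _

theorem isClosed_units [T2Space G] : IsClosed {u : G | r u = u} :=
  isClosed_eq continuous_r continuous_id

theorem measurable_ldiv [T2Space G] [SecondCountableTopology G] [MeasurableSpace G]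
    [BorelSpace G] : Measurable fun w : G × G => ldiv w.1 w.2 := by
  have hs : IsClosed {w : G × G | r w.1 = r w.2} :=
    isClosed_eq (continuous_r.comp continuous_fst) (continuous_r.comp continuous_snd)
  refine measurable_of_restrict_of_restrict_compl hs.measurableSet ?_ ?_
  · have : ({w : G × G | r w.1 = r w.2}.domRestrict fun w : G × G => ldiv w.1 w.2) =
        fun w => mul (inv w.1.1) w.1.2 ((d_inv _).trans w.2) := by
      ext w; exact ldiv_of_eq w.2
    rw [this]
    exact (continuous_gmul (continuous_inv.comp (continuous_fst.comp continuous_subtype_val))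
      (continuous_snd.comp continuous_subtype_val) _).measurable
  · have : ({w : G × G | r w.1 = r w.2}ᶜ.domRestrict fun w : G × G => ldiv w.1 w.2) =
        fun w => w.1.2 := by
      ext w; exact dif_neg w.2
    rw [this]
    exact measurable_snd.comp measurable_subtype_coe

end Continuity

theorem IsSystemOfMeasures.ae_eq {X Y : Type*} [MeasurableSpace X] [MeasurableSpace Y]
    {π : X → Y} {lam : Y → Measure X} (h : IsSystemOfMeasures π lam) (y : Y) :
    ∀ᵐ x ∂lam y, π x = y := by
  have := h.2 y
  rwa [← mem_ae_iff] at this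

/-- The translate of `E` in the definition of left invariance and the preimage of `E` under left
division agree on the fibre over `r x`, which carries `lam (rng x)`. The pushforward form is the one
that combines with products and integrals. -/
theorem IsLeftInvariant.map_ldiv [TopologicalSpace G] [IsTopologicalGroupoid G]
    [T2Space G] [MeasurableSpace G] [SecondCountableTopology G] [BorelSpace G]
    {lam : UnitSpace G → Measure G}
    (hs : IsSystemOfMeasures rng lam) (h : IsLeftInvariant lam) (x : G) :
    (lam (rng x)).map (ldiv x) = lam (dom x) := by
  have hm : Measurable (ldiv x) := measurable_ldiv.comp measurable_prodMk_left
  ext E hE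
  rw [Measure.map_apply hm hE, h x E hE]
  refine measure_congr ?_
  filter_upwards [hs.ae_eq (rng x)] with z hz
  have hz' : r x = r z := (congrArg Subtype.val hz).symm
  refine propext ⟨fun hzE => ⟨ldiv x z, ?_, hzE, ?_⟩, ?_⟩
  · rw [ldiv_of_eq hz', r_mul, r_inv]
  · exact (mul_inv_cancel_left x z hz').symm.trans
      (mul_congr rfl (ldiv_of_eq hz').symm _ _)
  · rintro ⟨y, hy, hyE, rfl⟩
    change ldiv x _ ∈ E
    rwa [ldiv_of_eq (r_mul _ _ _).symm, inv_mul_cancel_left]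

end TopologicalGroupoid

namespace WeakPullback

/-! ### Topology of the weak pullback -/

section Topology

variable {S G T : Type*} [TopologicalSpace S] [ArrowGroupoid S]
  [TopologicalSpace G] [ArrowGroupoid G] [TopologicalSpace T] [ArrowGroupoid T]
  {p : GpdHom S G} {q : GpdHom T G}

theorem continuous_unitIncl : Continuous (unitIncl p q) := by
  unfold unitIncl
  fun_prop

variable [IsTopologicalGroupoid G]

theorem continuous_mid (hp : Continuous p) (hq : Continuous q) :
    Continuous (mid : WeakPullback p q → G) := by
  have h1 : Continuous fun x : WeakPullback p q => p x.1.1 := by fun_prop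
  have h2 : Continuous fun x : WeakPullback p q => q x.1.2.2 := by fun_prop
  exact continuous_gmul (continuous_gmul (continuous_inv.comp h1) (by fun_prop) _) h2 _

theorem isClosed [T2Space G] (hp : Continuous p) (hq : Continuous q) :
    IsClosed {x : S × G × T | r x.2.1 = r (p x.1) ∧ d x.2.1 = r (q x.2.2)} := by
  refine (isClosed_eq ?_ ?_).inter (isClosed_eq ?_ ?_)
  · exact continuous_r.comp (by fun_prop)
  · exact continuous_r.comp (by fun_prop)
  · exact continuous_d.comp (by fun_prop)
  · exact continuous_r.comp (by fun_prop)

theorem isClosedEmbedding_val [T2Space G] (hp : Continuous p) (hq : Continuous q) :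
    IsClosedEmbedding (Subtype.val : WeakPullback p q → S × G × T) :=
  (isClosed hp hq).isClosedEmbedding_subtypeVal

variable [IsTopologicalGroupoid S] [IsTopologicalGroupoid T]

theorem isTopologicalGroupoid (hp : Continuous p) (hq : Continuous q) :
    IsTopologicalGroupoid (WeakPullback p q) where
  continuous_mul := by
    refine Continuous.subtype_mk (Continuous.prodMk ?_ (Continuous.prodMk ?_ ?_)) _
    · exact continuous_gmul (by fun_prop) (by fun_prop) _
    · fun_prop
    · exact continuous_gmul (by fun_prop) (by fun_prop) _
  continuous_inv := by
    refine Continuous.subtype_mk (Continuous.prodMk ?_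
      (Continuous.prodMk (continuous_mid hp hq) ?_)) _
    · exact continuous_inv.comp (by fun_prop)
    · exact continuous_inv.comp (by fun_prop)

theorem isClosedEmbedding_unitIncl [T2Space S] [T2Space G] [T2Space T]
    (hp : Continuous p) (hq : Continuous q) : IsClosedEmbedding (unitIncl p q) := by
  have := isTopologicalGroupoid hp hq
  have h1 : IsClosedEmbedding fun u : UnitSpace (WeakPullback p q) => (u.1.1 : S × G × T) :=
    (isClosedEmbedding_val hp hq).comp isClosed_units.isClosedEmbedding_subtypeVal
  have h2 : IsEmbedding fun w : UnitSpace S × G × UnitSpace T => (w.1.1, w.2.1, w.2.2.1) :=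
    IsEmbedding.subtypeVal.prodMap (IsEmbedding.id.prodMap IsEmbedding.subtypeVal)
  exact IsClosedEmbedding.of_comp h2 h1

end Topology

end WeakPullback

/-- Tietze extension, then positive part, then multiplication by a bump equal to 1 on the image of
the support. -/
theorem exists_nonneg_extension {A X : Type*} [TopologicalSpace A] [TopologicalSpace X]
    [T2Space X] [LocallyCompactSpace X] [NormalSpace X] {e : A → X} (he : IsClosedEmbedding e)
    {f : A → ℝ} (hf : Continuous f) (hs : HasCompactSupport f) (h0 : ∀ a, 0 ≤ f a) :
    ∃ F : X → ℝ, Continuous F ∧ HasCompactSupport F ∧ (∀ x, 0 ≤ F x) ∧ ∀ a, F (e a) = f a := by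
  obtain ⟨g, hg⟩ := ContinuousMap.exists_extension he (⟨f, hf⟩ : C(A, ℝ))
  obtain ⟨χ, hχc, hχs, hχ0, hχ1⟩ := exists_continuous_bump (hs.isCompact.image he.continuous)
  refine ⟨fun x => χ x * max (g x) 0, by fun_prop, hχs.mul_right,
    fun x => mul_nonneg (hχ0 x) (le_max_right _ _), fun a => ?_⟩
  have hga : g (e a) = f a := DFunLike.congr_fun hg a
  by_cases ha : a ∈ tsupport f
  · simp [hχ1 _ (mem_image_of_mem e ha), hga, h0 a]
  · simp [hga, image_eq_zero_of_notMem_tsupport ha]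

namespace WeakPullback

set_option linter.unusedSectionVars false

/-! ### The Haar system of the weak pullback -/

section HaarSystem

variable {S G T : Type*}
  [TopologicalSpace S] [SecondCountableTopology S] [T2Space S]
  [MeasurableSpace S] [BorelSpace S] [ArrowGroupoid S] [IsTopologicalGroupoid S]
  [TopologicalSpace G] [SecondCountableTopology G] [T2Space G]
  [MeasurableSpace G] [BorelSpace G] [ArrowGroupoid G] [IsTopologicalGroupoid G]
  [TopologicalSpace T] [SecondCountableTopology T] [T2Space T]
  [MeasurableSpace T] [BorelSpace T] [ArrowGroupoid T] [IsTopologicalGroupoid T]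
  {p : GpdHom S G} {q : GpdHom T G}
  {lamS : UnitSpace S → Measure S} {lamT : UnitSpace T → Measure T}

instance : BorelSpace (WeakPullback p q) :=
  Subtype.borelSpace {x : S × G × T | r x.2.1 = r (p x.1) ∧ d x.2.1 = r (q x.2.2)}

theorem measurableEmbedding_val (hp : Continuous p) (hq : Continuous q) :
    MeasurableEmbedding (Subtype.val : WeakPullback p q → S × G × T) :=
  .subtype_coe (isClosed hp hq).measurableSet

theorem measurableEmbedding_unitIncl (hp : Continuous p) (hq : Continuous q) :
    MeasurableEmbedding (unitIncl p q) :=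
  (isClosedEmbedding_unitIncl hp hq).measurableEmbedding

theorem ae_prod_dirac_prod [∀ s, SFinite (lamS s)] [∀ t, SFinite (lamT t)]
    (hS : IsSystemOfMeasures rng lamS) (hT : IsSystemOfMeasures rng lamT)
    (s : UnitSpace S) (g : G) (t : UnitSpace T) :
    ∀ᵐ w ∂(lamS s).prod ((Measure.dirac g).prod (lamT t)),
      rng w.1 = s ∧ w.2.1 = g ∧ rng w.2.2 = t := by
  have h1 := Measure.quasiMeasurePreserving_fst
    (μ := lamS s) (ν := (Measure.dirac g).prod (lamT t)) |>.ae (hS.ae_eq s)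
  have h2 := Measure.quasiMeasurePreserving_snd
    (μ := lamS s) (ν := (Measure.dirac g).prod (lamT t)) |>.ae
    (Measure.quasiMeasurePreserving_fst.ae (p := (· = g)) (by simp [ae_dirac_eq]))
  have h3 := Measure.quasiMeasurePreserving_snd
    (μ := lamS s) (ν := (Measure.dirac g).prod (lamT t)) |>.ae
    (Measure.quasiMeasurePreserving_snd.ae (hT.ae_eq t))
  filter_upwards [h1, h2, h3] with w a b c using ⟨a, b, c⟩


variable [∀ s, SFinite (lamS s)] [∀ t, SFinite (lamT t)]
  (hS : IsSystemOfMeasures rng lamS) (hT : IsSystemOfMeasures rng lamT)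
  (hp : Continuous p) (hq : Continuous q)

include hS hT hp hq

/-- The product measure is concentrated on `P`: almost surely the outer coordinates have ranges `s`
and `t` and the middle one is `g`, so the defining equations are inherited from the unit. Hence
restricting to `P` loses no mass. -/
theorem map_val_haarSystem (u : UnitSpace (WeakPullback p q)) :
    (haarSystem p q lamS lamT u).map Subtype.val =
      (lamS (unitIncl p q u).1).prod
        ((Measure.dirac (unitIncl p q u).2.1).prod (lamT (unitIncl p q u).2.2)) := by
  rw [haarSystem, (measurableEmbedding_val hp hq).map_comap]
  refine Measure.restrict_eq_self_of_ae_mem ?_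
  filter_upwards [ae_prod_dirac_prod hS hT _ _ _] with w ⟨h1, h2, h3⟩
  have e1 : r w.1 = u.1.1.1 := congrArg Subtype.val h1
  have e3 : r w.2.2 = u.1.1.2.2 := congrArg Subtype.val h3
  refine ⟨⟨w, ?_, ?_⟩, rfl⟩
  · rw [h2, ← p.map_r, e1]
    exact u.1.2.1.trans ((p.map_r _).symm.trans (congrArg p (unitIncl p q u).1.2))
  · rw [h2, ← q.map_r, e3]
    exact u.1.2.2.trans ((q.map_r _).symm.trans (congrArg q (unitIncl p q u).2.2.2))

theorem haarSystem_apply (u : UnitSpace (WeakPullback p q)) (E : Set (WeakPullback p q)) :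
    haarSystem p q lamS lamT u E = (lamS (unitIncl p q u).1).prod
        ((Measure.dirac (unitIncl p q u).2.1).prod (lamT (unitIncl p q u).2.2))
          (Subtype.val '' E) :=
  (measurableEmbedding_val hp hq).comap_apply _ _

theorem isSystemOfMeasures_haarSystem :
    IsSystemOfMeasures rng (haarSystem p q lamS lamT) := by
  have := isTopologicalGroupoid hp hq
  refine ⟨continuous_rng.measurable, fun u => ?_⟩
  rw [← mem_ae_iff]
  have h := ae_prod_dirac_prod hS hT (unitIncl p q u).1 (unitIncl p q u).2.1 (unitIncl p q u).2.2
  rw [← map_val_haarSystem hS hT hp hq] at h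
  filter_upwards [ae_of_ae_map (measurableEmbedding_val hp hq).measurable.aemeasurable h]
    with x ⟨h1, h2, h3⟩
  exact Subtype.ext (ext' (congrArg Subtype.val h1) h2 (congrArg Subtype.val h3))

theorem isPositiveOnOpens_haarSystem (hS' : IsPositiveOnOpens rng lamS)
    (hT' : IsPositiveOnOpens rng lamT) :
    IsPositiveOnOpens rng (haarSystem p q lamS lamT) := by
  rintro u A hA ⟨x, hxA, rfl⟩
  obtain ⟨B, hB, rfl⟩ := isOpen_induced_iff.1 hA
  rw [← Measure.map_apply (measurableEmbedding_val hp hq).measurable hB.measurableSet,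
    map_val_haarSystem hS hT hp hq]
  obtain ⟨U, V', hU, hV', hxU, hxV', hUV⟩ := isOpen_prod_iff.1 hB x.1.1 x.1.2 hxA
  obtain ⟨V, W, hV, hW, hxV, hxW, hVW⟩ := isOpen_prod_iff.1 hV' x.1.2.1 x.1.2.2 hxV'
  refine lt_of_lt_of_le ?_ (measure_mono ((prod_mono_right hVW).trans hUV))
  rw [Measure.prod_prod, Measure.prod_prod]
  refine ENNReal.mul_pos (hS' _ U hU ⟨x.1.1, hxU, rfl⟩).ne' (mul_ne_zero ?_
    (hT' _ W hW ⟨x.1.2.2, hxW, rfl⟩).ne')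
  rw [Measure.dirac_apply_of_mem]
  · exact one_ne_zero
  · exact hxV

/-- Left division in `S` and in `T` carries the outer factors over the range of `x` to those over
its domain, and a constant map moves the Dirac mass. It remains to match translation in `P` with
this product map on the carrying fibre. -/
theorem isLeftInvariant_haarSystem (hS' : IsLeftInvariant lamS)
    (hT' : IsLeftInvariant lamT) : IsLeftInvariant (haarSystem p q lamS lamT) := by
  intro x E hE
  rw [haarSystem_apply hS hT hp hq, haarSystem_apply hS hT hp hq]
  change (lamS (dom x.1.1)).prod ((Measure.dirac x.mid).prod (lamT (dom x.1.2.2))) _ =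
    (lamS (rng x.1.1)).prod ((Measure.dirac x.1.2.1).prod (lamT (rng x.1.2.2))) _
  have mS : Measurable (ldiv x.1.1) := measurable_ldiv.comp measurable_prodMk_left
  have mT : Measurable (ldiv x.1.2.2) := measurable_ldiv.comp measurable_prodMk_left
  have hmap : Measure.dirac x.mid =
      (Measure.dirac x.1.2.1).map (fun _ : G => x.mid) := by
    rw [Measure.map_dirac' measurable_const]
  rw [← hS'.map_ldiv hS, ← hT'.map_ldiv hT, hmap, Measure.map_prod_map _ _ measurable_const mT,
    Measure.map_prod_map _ _ mS (measurable_const.prodMap mT), Measure.map_apply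
      (mS.prodMap (measurable_const.prodMap mT))
      ((measurableEmbedding_val hp hq).measurableSet_image.2 hE)]
  refine measure_congr ?_
  filter_upwards [ae_prod_dirac_prod hS hT (rng x.1.1) x.1.2.1 (rng x.1.2.2)]
    with w ⟨h1, h2, h3⟩
  have e1 : r x.1.1 = r w.1 := (congrArg Subtype.val h1).symm
  have e3 : r x.1.2.2 = r w.2.2 := (congrArg Subtype.val h3).symm
  refine propext ⟨?_, ?_⟩
  · rintro ⟨y, hyE, hy⟩
    have y1 : y.1.1 = ldiv x.1.1 w.1 := congrArg Prod.fst hy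
    have y2 : y.1.2.1 = x.mid := congrArg (fun z => z.2.1) hy
    have y3 : y.1.2.2 = ldiv x.1.2.2 w.2.2 := congrArg (fun z => z.2.2) hy
    have hxy : d x = r y := by
      refine ext' ?_ y2.symm ?_
      · change d x.1.1 = r y.1.1
        rw [y1, ldiv_of_eq e1, r_mul, r_inv]
      · change d x.1.2.2 = r y.1.2.2
        rw [y3, ldiv_of_eq e3, r_mul, r_inv]
    refine ⟨mul x y hxy, ⟨y, hxy, hyE, rfl⟩, Prod.ext ?_ (Prod.ext h2.symm ?_)⟩
    · exact (mul_congr rfl (y1.trans (ldiv_of_eq e1)) _ _).trans (mul_inv_cancel_left _ _ e1)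
    · exact (mul_congr rfl (y3.trans (ldiv_of_eq e3)) _ _).trans (mul_inv_cancel_left _ _ e3)
  · rintro ⟨_, ⟨y, hxy, hyE, rfl⟩, hz⟩
    obtain ⟨c1, c2, c3⟩ := composable hxy
    refine ⟨y, hyE, ?_⟩
    rw [← hz]
    refine Prod.ext ?_ (Prod.ext c2.symm ?_)
    · change y.1.1 = ldiv x.1.1 (mul x.1.1 y.1.1 c1)
      rw [ldiv_of_eq (r_mul _ _ _).symm, inv_mul_cancel_left]
    · change y.1.2.2 = ldiv x.1.2.2 (mul x.1.2.2 y.1.2.2 c3)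
      rw [ldiv_of_eq (r_mul _ _ _).symm, inv_mul_cancel_left]

/-- After extending `f` to the full product, the middle coordinate is only a parameter. Continuity
of the integral follows by integrating out `t` and then `s`, each time treating the remaining
variables as parameters. -/
theorem isCSM_haarSystem [LocallyCompactSpace S] [LocallyCompactSpace G] [LocallyCompactSpace T]
    (hS' : IsCSM rng lamS) (hT' : IsCSM rng lamT) :
    IsCSM rng (haarSystem p q lamS lamT) := by
  have := isTopologicalGroupoid hp hq
  have := fun s => hS'.isLocallyBounded.isLocallyFiniteMeasure s
  have := fun t => hT'.isLocallyBounded.isLocallyFiniteMeasure t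
  refine ⟨isSystemOfMeasures_haarSystem hS hT hp hq, continuous_rng, fun f hf hfs hf0 => ?_⟩
  have hemb := measurableEmbedding_val hp hq
  obtain ⟨F, hF, hFs, hF0, hFf⟩ :=
    exists_nonneg_extension (isClosedEmbedding_val hp hq) hf hfs hf0
  have hfF : f = fun x => F x.1 := funext fun x => (hFf x).symm
  have hmap : ∀ u, (haarSystem p q lamS lamT u).map Subtype.val =
      ((lamS (unitIncl p q u).1).prod (lamT (unitIncl p q u).2.2)).map
        (fun w => (w.1, (unitIncl p q u).2.1, w.2)) := by
    intro u
    rw [map_val_haarSystem hS hT hp hq, Measure.dirac_prod]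
    conv_lhs => rw [← Measure.map_id (μ := lamS (unitIncl p q u).1)]
    rw [Measure.map_prod_map _ _ measurable_id measurable_prodMk_left]
    rfl
  have hsec : ∀ g, Continuous fun w : S × T => F (w.1, g, w.2) := fun g => by fun_prop
  have hcs : ∀ g, HasCompactSupport fun w : S × T => F (w.1, g, w.2) := fun g =>
    HasCompactSupport.intro ((hFs.isCompact.image (f := fun w : S × G × T => (w.1, w.2.2))
      (by fun_prop))) fun w hw => by
        by_contra hne
        exact hw ⟨(w.1, g, w.2), subset_tsupport _ hne, rfl⟩
  have hi : ∀ u : UnitSpace (WeakPullback p q), Integrable (fun w : S × T =>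
      F (w.1, (unitIncl p q u).2.1, w.2))
        ((lamS (unitIncl p q u).1).prod (lamT (unitIncl p q u).2.2)) :=
    fun u => (hsec _).integrable_of_hasCompactSupport (hcs _)
  refine ⟨fun u => ?_, ?_⟩
  · rw [hfF]
    refine (hemb.integrable_map_iff (g := F)).1 ?_
    rw [hmap, integrable_map_measure hF.aestronglyMeasurable (by fun_prop)]
    exact hi u
  · have hint : (fun u => ∫ x, f x ∂haarSystem p q lamS lamT u) = fun u =>
        ∫ s, ∫ t, F (s, (unitIncl p q u).2.1, t) ∂lamT (unitIncl p q u).2.2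
          ∂lamS (unitIncl p q u).1 := by
      ext u
      rw [hfF, ← hemb.integral_map F, hmap, integral_map (by fun_prop)
        hF.aestronglyMeasurable, integral_prod _ (hi u)]
    rw [hint]
    have hT1 := hT'.continuous_integral_prod (Z := S × G)
      (F := fun w => F (w.2.1, w.2.2, w.1)) (by fun_prop) (fun _ => hF0 _)
      (hFs.isCompact.image (f := fun w => w.2.2) (by fun_prop)) (fun t z ht => by
        by_contra hne
        exact ht ⟨(z.1, z.2, t), subset_tsupport _ hne, rfl⟩)
    have hS1 := hS'.continuous_integral_prod (Z := G × UnitSpace T)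
      (F := fun w => ∫ t, F (w.1, w.2.1, t) ∂lamT w.2.2)
      (hT1.comp (by fun_prop : Continuous fun w : S × G × UnitSpace T =>
        (w.2.2, (w.1, w.2.1))))
      (fun _ => integral_nonneg fun _ => hF0 _)
      (hFs.isCompact.image continuous_fst) (fun s z hs => by
        have : ∀ t, F (s, z.1, t) = 0 := fun t => by
          by_contra hne
          exact hs ⟨(s, z.1, t), subset_tsupport _ hne, rfl⟩
        simp [this])
    exact hS1.comp (continuous_unitIncl (p := p) (q := q))

end HaarSystem
end WeakPullback

theorem quasiMeasurePreserving_of_lintegral {X Y : Type*} [MeasurableSpace X] [MeasurableSpace Y]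
    {μ : Measure X} {ν : Measure Y} {f : X → Y} (hf : Measurable f)
    (h : ∀ F : Y → ℝ≥0∞, Measurable F → ∫⁻ y, F y ∂ν = 0 → ∫⁻ x, F (f x) ∂μ = 0) :
    Measure.QuasiMeasurePreserving f μ ν := by
  refine ⟨hf, Measure.AbsolutelyContinuous.mk fun E hE h0 => ?_⟩
  have hF : Measurable (E.indicator 1 : Y → ℝ≥0∞) := measurable_one.indicator hE
  rw [← lintegral_indicator_one hE] at h0 ⊢
  rw [lintegral_map hF hf]
  exact h _ hF h0

/-! ### Non-singular maps for the measures $\int\rho^{r(x)}\times\delta_x\times\tau^{d(x)}\,dm(x)$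
-/

section Weak

variable {S G T : Type*} [MeasurableSpace S]
  [TopologicalSpace G]
  [MeasurableSpace G] [BorelSpace G] [ArrowGroupoid G] [IsTopologicalGroupoid G]
  [MeasurableSpace T]

/-- The kernel `x ↦ ρ^{r(x)} × δ_x × τ^{d(x)}`. -/
noncomputable def weakKernel (ρ : Kernel (UnitSpace G) S) (τ : Kernel (UnitSpace G) T) :
    Kernel G (S × G × T) :=
  (ρ.comap rng continuous_rng.measurable) ×ₖ
    (Kernel.id ×ₖ (τ.comap dom continuous_dom.measurable))

variable (ρ : Kernel (UnitSpace G) S) [IsSFiniteKernel ρ]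
  (τ : Kernel (UnitSpace G) T) [IsSFiniteKernel τ]

theorem weakKernel_apply (x : G) : weakKernel ρ τ x =
    (ρ (rng x)).prod ((Measure.dirac x).prod (τ (dom x))) := by
  rw [weakKernel, Kernel.prod_apply, Kernel.prod_apply, Kernel.id_apply, Kernel.comap_apply,
    Kernel.comap_apply]

theorem lintegral_weakKernel {F : S × G × T → ℝ≥0∞} (hF : Measurable F) (x : G) :
    ∫⁻ w, F w ∂weakKernel ρ τ x = ∫⁻ s, ∫⁻ t, F (s, x, t) ∂τ (dom x) ∂ρ (rng x) := by
  rw [weakKernel, Kernel.lintegral_prod _ _ _ hF, Kernel.comap_apply]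
  refine lintegral_congr fun s => ?_
  rw [Kernel.lintegral_id_prod (f := fun w => F (s, w)) (by fun_prop), Kernel.comap_apply]

theorem lintegral_bind_weakKernel (m : Measure G) {F : S × G × T → ℝ≥0∞} (hF : Measurable F) :
    ∫⁻ w, F w ∂m.bind (weakKernel ρ τ) =
      ∫⁻ x, ∫⁻ s, ∫⁻ t, F (s, x, t) ∂τ (dom x) ∂ρ (rng x) ∂m := by
  rw [Measure.lintegral_bind (Kernel.measurable _).aemeasurable hF.aemeasurable]
  exact lintegral_congr fun x => lintegral_weakKernel ρ τ hF x

/-- The exchange of the two legs of the weak pullback is non-singular. -/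
theorem quasiMeasurePreserving_swap {m : Measure G} (hm : m.map inv ≪ m) :
    Measure.QuasiMeasurePreserving (fun w : S × G × T => (w.2.2, inv w.2.1, w.1))
      (m.bind (weakKernel ρ τ)) (m.bind (weakKernel τ ρ)) := by
  have hinv : Measurable (inv : G → G) := continuous_inv.measurable
  have hmeas : Measurable fun w : S × G × T => (w.2.2, inv w.2.1, w.1) := by fun_prop
  refine quasiMeasurePreserving_of_lintegral hmeas fun F hF h0 => ?_
  rw [Measure.lintegral_bind (Kernel.measurable _).aemeasurable hF.aemeasurable,
    lintegral_eq_zero_iff hF.lintegral_kernel] at h0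
  rw [lintegral_bind_weakKernel _ _ _ (F := fun w => F (_, _, _)) (hF.comp hmeas)]
  have hq : Measure.QuasiMeasurePreserving (inv : G → G) m m := ⟨hinv, hm⟩
  refine (lintegral_congr_ae ?_).trans lintegral_zero
  filter_upwards [hq.ae h0] with x hx
  rw [lintegral_weakKernel _ _ hF] at hx
  have e1 : rng (inv x) = dom x := Subtype.ext (r_inv x)
  have e2 : dom (inv x) = rng x := Subtype.ext (d_inv x)
  rw [e1, e2] at hx
  -- Inversion has exchanged `rng` and `dom`, so the two integrals differ only in the order of `S`
  -- and `T`.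
  rw [lintegral_lintegral_swap]
  · exact hx
  · exact (hF.comp (by fun_prop : Measurable fun w : S × T => (w.2, inv x, w.1))).aemeasurable

variable (lam : Kernel (UnitSpace G) G) [IsSFiniteKernel lam]
  (mu : Measure (UnitSpace G)) {p : S → G}

theorem measurable_lintegral_dom {F : S × G × T → ℝ≥0∞} (hF : Measurable F) :
    Measurable fun w : S × G => ∫⁻ t, F (w.1, w.2, t) ∂τ (dom w.2) :=
  Measurable.lintegral_kernel_prod_right'
    (κ := τ.comap (fun w : S × G => dom w.2) (continuous_dom.measurable.comp measurable_snd))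
    (f := fun w : (S × G) × T => F (w.1.1, w.1.2, w.2)) (by fun_prop)

theorem measurable_lintegral_rng (hp : Measurable p) {F : S × G × T → ℝ≥0∞}
    (hF : Measurable F) :
    Measurable fun s => ∫⁻ x, ∫⁻ t, F (s, x, t) ∂τ (dom x) ∂lam (rng (p s)) :=
  Measurable.lintegral_kernel_prod_right'
    (κ := lam.comap (fun s : S => rng (p s)) (continuous_rng.measurable.comp hp))
    (measurable_lintegral_dom τ hF)

/-- Over a fixed unit `u` the variables `x` and `s` are independent, because `rng x = u` almost
surely; Tonelli then allows `s` to be chosen first. Since also `rng (p s) = u` almost surely, `u`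
can be eliminated in favour of `s`. -/
theorem lintegral_bind_weakKernel_of_disintegration (hlam : IsSystemOfMeasures rng lam)
    (hp : Measurable p) (hρ : ∀ u, ∀ᵐ s ∂ρ u, rng (p s) = u)
    {F : S × G × T → ℝ≥0∞} (hF : Measurable F) :
    ∫⁻ w, F w ∂(mu.bind lam).bind (weakKernel ρ τ) =
      ∫⁻ s, ∫⁻ x, ∫⁻ t, F (s, x, t) ∂τ (dom x) ∂lam (rng (p s)) ∂mu.bind ρ := by
  have hH := measurable_lintegral_dom τ hF
  have hJ := measurable_lintegral_rng τ lam hp hF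
  have hL : Measurable fun x => ∫⁻ s, ∫⁻ t, F (s, x, t) ∂τ (dom x) ∂ρ (rng x) := by
    simpa only [lintegral_weakKernel ρ τ hF] using hF.lintegral_kernel (κ := weakKernel ρ τ)
  rw [lintegral_bind_weakKernel _ _ _ hF,
    Measure.lintegral_bind lam.measurable.aemeasurable hL.aemeasurable,
    Measure.lintegral_bind ρ.measurable.aemeasurable hJ.aemeasurable]
  refine lintegral_congr fun u => ?_
  calc _ = ∫⁻ x, ∫⁻ s, ∫⁻ t, F (s, x, t) ∂τ (dom x) ∂ρ u ∂lam u := by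
        refine lintegral_congr_ae ?_
        filter_upwards [hlam.ae_eq u] with x hx
        rw [hx]
    _ = ∫⁻ s, ∫⁻ x, ∫⁻ t, F (s, x, t) ∂τ (dom x) ∂lam u ∂ρ u :=
        lintegral_lintegral_swap (hH.comp measurable_swap).aemeasurable
    _ = _ := by
        refine lintegral_congr_ae ?_
        filter_upwards [hρ u] with s hs
        rw [hs]

/-- Translation by the inverse in the first leg of the weak pullback is non-singular. -/
theorem quasiMeasurePreserving_translate [SecondCountableTopology G] [T2Space G] [ArrowGroupoid S]
    (hlam : IsSystemOfMeasures rng lam)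
    (hinv : IsLeftInvariant lam) (hp : Measurable p)
    (hρ : ∀ u, ∀ᵐ s ∂ρ u, rng (p s) = u) (hiS : Measurable (inv : S → S))
    (hpi : ∀ s, p (inv s) = inv (p s)) (hqi : (mu.bind ρ).map inv ≪ mu.bind ρ) :
    Measure.QuasiMeasurePreserving (fun w : S × G × T => (inv w.1, ldiv (p w.1) w.2.1, w.2.2))
      ((mu.bind lam).bind (weakKernel ρ τ)) ((mu.bind lam).bind (weakKernel ρ τ)) := by
  have hdiv : Measurable fun w : S × G × T => ldiv (p w.1) w.2.1 :=
    measurable_ldiv.comp (by fun_prop : Measurable fun w : S × G × T => (p w.1, w.2.1))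
  have hmeas : Measurable fun w : S × G × T => (inv w.1, ldiv (p w.1) w.2.1, w.2.2) := by
    fun_prop
  refine quasiMeasurePreserving_of_lintegral hmeas fun F hF h0 => ?_
  have hH := measurable_lintegral_dom τ hF
  have hJ := measurable_lintegral_rng τ lam hp hF
  rw [lintegral_bind_weakKernel_of_disintegration ρ τ lam mu hlam hp hρ hF,
    lintegral_eq_zero_iff hJ] at h0
  rw [lintegral_bind_weakKernel_of_disintegration ρ τ lam mu hlam hp hρ
    (F := fun w => F (_, _, _)) (hF.comp hmeas)]
  have hq : Measure.QuasiMeasurePreserving (inv : S → S) (mu.bind ρ) (mu.bind ρ) := ⟨hiS, hqi⟩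
  refine (lintegral_congr_ae ?_).trans lintegral_zero
  -- Quasi-invariance moves the vanishing of the inner integral from `s` to `inv s`. The fibre there
  -- is the one over `d (p s)`, which left division by `p s` reaches from the fibre over `r (p s)`.
  filter_upwards [hq.ae h0] with s hs
  have e1 : rng (p (inv s)) = dom (p s) := by rw [hpi]; exact Subtype.ext (r_inv _)
  have hm : Measurable (ldiv (p s)) := measurable_ldiv.comp measurable_prodMk_left
  have hH' : Measurable fun x => ∫⁻ t, F (inv s, x, t) ∂τ (dom x) :=
    hH.comp measurable_prodMk_left
  rw [e1, ← hinv.map_ldiv hlam, lintegral_map hH' hm] at hs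
  have e2 : ∀ x, dom (ldiv (p s) x) = dom x := fun x => Subtype.ext (d_ldiv _ _)
  simpa only [e2, Pi.zero_apply] using hs

end Weak

namespace WeakPullback

/-! ### The measure on the units and the measure it induces -/

section UnitMeasure

set_option linter.unusedSectionVars false

variable {S G T : Type*}
  [TopologicalSpace S] [SecondCountableTopology S] [T2Space S]
  [MeasurableSpace S] [BorelSpace S] [ArrowGroupoid S] [IsTopologicalGroupoid S]
  [TopologicalSpace G] [SecondCountableTopology G] [T2Space G]
  [MeasurableSpace G] [BorelSpace G] [ArrowGroupoid G] [IsTopologicalGroupoid G]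
  [TopologicalSpace T] [SecondCountableTopology T] [T2Space T]
  [MeasurableSpace T] [BorelSpace T] [ArrowGroupoid T] [IsTopologicalGroupoid T]
  {p : GpdHom S G} {q : GpdHom T G}
  {lamS : Kernel (UnitSpace S) S} [IsSFiniteKernel lamS]
  {lamT : Kernel (UnitSpace T) T} [IsSFiniteKernel lamT]
  {γp : Kernel (UnitSpace G) (UnitSpace S)} [IsSFiniteKernel γp]
  {γq : Kernel (UnitSpace G) (UnitSpace T)} [IsSFiniteKernel γq]

theorem measurable_haarSystem (hp : Continuous p) (hq : Continuous q) :
    Measurable (haarSystem p q lamS lamT) := by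
  have hi : Measurable (unitIncl p q) := continuous_unitIncl.measurable
  let κ : Kernel (UnitSpace S × G × UnitSpace T) (S × G × T) :=
    (lamS.comap (fun v => v.1) measurable_fst) ×ₖ
      ((Kernel.deterministic (fun v => v.2.1) (by fun_prop)) ×ₖ
        (lamT.comap (fun v => v.2.2) (by fun_prop)))
  have : haarSystem p q lamS lamT =
      (κ.comap (unitIncl p q) hi).comapRight (measurableEmbedding_val hp hq) := by
    ext1 u
    rw [Kernel.comapRight_apply, Kernel.comap_apply, Kernel.prod_apply, Kernel.prod_apply,
      Kernel.deterministic_apply, Kernel.comap_apply, Kernel.comap_apply]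
    rfl
  rw [this]
  exact Kernel.measurable _

theorem measurable_eta (hp : Continuous p) (hq : Continuous q) :
    Measurable (eta p q γp γq) := by
  have : eta p q γp γq =
      (weakKernel γp γq).comapRight (measurableEmbedding_unitIncl hp hq) := by
    ext1 x
    rw [Kernel.comapRight_apply, weakKernel_apply]
    rfl
  rw [this]
  exact Kernel.measurable _

theorem map_unitIncl_eta (hp : Continuous p) (hq : Continuous q)
    (hγp : IsSystemOfMeasures p.onUnits γp) (hγq : IsSystemOfMeasures q.onUnits γq) (x : G) :
    (eta p q γp γq x).map (unitIncl p q) = weakKernel γp γq x := by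
  rw [eta, (measurableEmbedding_unitIncl hp hq).map_comap, weakKernel_apply]
  refine Measure.restrict_eq_self_of_ae_mem ?_
  have h1 := Measure.quasiMeasurePreserving_fst
    (μ := γp (rng x)) (ν := (Measure.dirac x).prod (γq (dom x))) |>.ae (hγp.ae_eq _)
  have h2 := Measure.quasiMeasurePreserving_snd
    (μ := γp (rng x)) (ν := (Measure.dirac x).prod (γq (dom x))) |>.ae
    (Measure.quasiMeasurePreserving_fst.ae (p := (· = x)) (by simp [ae_dirac_eq]))
  have h3 := Measure.quasiMeasurePreserving_snd
    (μ := γp (rng x)) (ν := (Measure.dirac x).prod (γq (dom x))) |>.ae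
    (Measure.quasiMeasurePreserving_snd.ae (hγq.ae_eq _))
  filter_upwards [h1, h2, h3] with w a b c
  have a' : p w.1.1 = r x := congrArg Subtype.val a
  have c' : q w.2.2.1 = d x := congrArg Subtype.val c
  refine ⟨⟨⟨(w.1.1, w.2.1, w.2.2.1), ?_, ?_⟩, ?_⟩, rfl⟩
  · change r w.2.1 = r (p w.1.1)
    rw [a', b, r_r]
  · change d w.2.1 = r (q w.2.2.1)
    rw [c', b, r_d]
  · exact ext' w.1.2 rfl w.2.2.2

/-- The induced measure of the weak pullback, as a measure on `S × G × T`. -/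
theorem map_val_inducedMeasure (hp : Continuous p) (hq : Continuous q)
    (hS : IsSystemOfMeasures rng lamS) (hT : IsSystemOfMeasures rng lamT)
    (hγp : IsSystemOfMeasures p.onUnits γp) (hγq : IsSystemOfMeasures q.onUnits γq)
    (lamG : UnitSpace G → Measure G) (muG : Measure (UnitSpace G)) :
    (inducedMeasure (haarSystem p q lamS lamT) (unitMeasure p q lamG muG γp γq)).map
      Subtype.val = (muG.bind lamG).bind (weakKernel (lamS ∘ₖ γp) (lamT ∘ₖ γq)) := by
  have hval := (measurableEmbedding_val hp hq (p := p) (q := q)).measurable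
  have hincl := (measurableEmbedding_unitIncl hp hq (p := p) (q := q)).measurable
  refine Measure.ext_of_lintegral _ fun F hF => ?_
  have hQ : Measurable fun v : UnitSpace S × G × UnitSpace T =>
      ∫⁻ s, ∫⁻ t, F (s, v.2.1, t) ∂lamT v.2.2 ∂lamS v.1 := by
    have h1 : Measurable fun w : (UnitSpace S × G × UnitSpace T) × S =>
        ∫⁻ t, F (w.2, w.1.2.1, t) ∂lamT w.1.2.2 :=
      Measurable.lintegral_kernel_prod_right'
        (κ := lamT.comap (fun w : (UnitSpace S × G × UnitSpace T) × S => w.1.2.2) (by fun_prop))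
        (f := fun w => F (w.1.2, w.1.1.2.1, w.2)) (by fun_prop)
    exact Measurable.lintegral_kernel_prod_right'
      (κ := lamS.comap (fun v : UnitSpace S × G × UnitSpace T => v.1) (by fun_prop)) h1
  have hhaar : ∀ u, ∫⁻ x, F x.1 ∂haarSystem p q lamS lamT u =
      ∫⁻ s, ∫⁻ t, F (s, (unitIncl p q u).2.1, t) ∂lamT (unitIncl p q u).2.2
        ∂lamS (unitIncl p q u).1 := by
    intro u
    rw [← lintegral_map hF hval, map_val_haarSystem hS hT hp hq,
      lintegral_prod _ hF.aemeasurable]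
    refine lintegral_congr fun s => ?_
    rw [Measure.dirac_prod, lintegral_map (f := fun w => F (s, w)) (by fun_prop) (by fun_prop)]
  rw [lintegral_map hF hval, lintegral_bind_weakKernel _ _ _ hF, inducedMeasure, unitMeasure,
    Measure.lintegral_bind (f := fun x : WeakPullback p q => F x.1)
      (measurable_haarSystem hp hq).aemeasurable (hF.comp hval).aemeasurable]
  simp only [hhaar]
  rw [Measure.lintegral_bind (f := fun u => ∫⁻ s, ∫⁻ t,
    F (s, (unitIncl p q u).2.1, t) ∂lamT (unitIncl p q u).2.2 ∂lamS (unitIncl p q u).1)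
    (measurable_eta hp hq).aemeasurable (hQ.comp hincl).aemeasurable]
  refine lintegral_congr fun x => ?_
  rw [← lintegral_map hQ hincl, map_unitIncl_eta hp hq hγp hγq, lintegral_weakKernel _ _ hQ]
  have hm1 : Measurable fun s => ∫⁻ t, F (s, x, t) ∂(lamT ∘ₖ γq) (dom x) :=
    Measurable.lintegral_prod_right' (f := fun w : S × T => F (w.1, x, w.2)) (by fun_prop)
  rw [Kernel.lintegral_comp _ _ _ hm1]
  refine lintegral_congr fun s₀ => ?_
  have hm2 : ∀ s, Measurable fun t => F (s, x, t) := fun s => by fun_prop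
  simp only [Kernel.lintegral_comp _ _ _ (hm2 _)]
  -- The sides differ only in the order of integration over `s` and over the unit of `T`.
  rw [lintegral_lintegral_swap]
  exact (Measurable.lintegral_kernel_prod_right'
    (κ := lamT.comap (fun w : UnitSpace T × S => w.1) (by fun_prop))
    (f := fun w => F (w.1.2, x, w.2)) (by fun_prop)).aemeasurable

theorem unitMeasure_apply (hp : Continuous p) (hq : Continuous q)
    (hγp : IsSystemOfMeasures p.onUnits γp) (hγq : IsSystemOfMeasures q.onUnits γq)
    (lamG : UnitSpace G → Measure G) (muG : Measure (UnitSpace G))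
    {E : Set (UnitSpace S × G × UnitSpace T)} (hE : MeasurableSet E) :
    unitMeasure p q lamG muG γp γq (unitIncl p q ⁻¹' E) =
      ∫⁻ x, weakKernel γp γq x E ∂muG.bind lamG := by
  have hincl := (measurableEmbedding_unitIncl hp hq (p := p) (q := q)).measurable
  rw [unitMeasure, Measure.bind_apply (hincl hE) (measurable_eta hp hq).aemeasurable]
  refine lintegral_congr fun x => ?_
  rw [← map_unitIncl_eta hp hq hγp hγq, Measure.map_apply hincl hE]

/-- A box with sides `U`, `V`, `W` has mass at most `C * D` times the `G`-measure of `V`. The bounds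
on `U` and `W` are uniform over the base, so they leave the integral. -/
theorem isLocallyFiniteMeasure_unitMeasure (hp : Continuous p) (hq : Continuous q)
    (hγp : IsSystemOfMeasures p.onUnits γp) (hγq : IsSystemOfMeasures q.onUnits γq)
    (hγp' : IsLocallyBounded γp) (hγq' : IsLocallyBounded γq)
    (lamG : UnitSpace G → Measure G) (muG : Measure (UnitSpace G))
    [IsLocallyFiniteMeasure (muG.bind lamG)] :
    IsLocallyFiniteMeasure (unitMeasure p q lamG muG γp γq) := by
  refine ⟨fun u => ?_⟩
  obtain ⟨U, hU, C, -, hC⟩ := hγp' (unitIncl p q u).1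
  obtain ⟨W, hW, D, -, hD⟩ := hγq' (unitIncl p q u).2.2
  obtain ⟨V, hV, hVo, hVf⟩ := (muG.bind lamG).exists_isOpen_measure_lt_top (unitIncl p q u).2.1
  have hE : MeasurableSet (interior U ×ˢ V ×ˢ interior W) :=
    isOpen_interior.measurableSet.prod (hVo.measurableSet.prod isOpen_interior.measurableSet)
  refine ⟨unitIncl p q ⁻¹' (interior U ×ˢ V ×ˢ interior W),
    continuous_unitIncl.continuousAt.preimage_mem_nhds ?_, ?_⟩
  · exact prod_mem_nhds (interior_mem_nhds.2 hU)
      (prod_mem_nhds (hVo.mem_nhds hV) (interior_mem_nhds.2 hW))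
  · rw [unitMeasure_apply hp hq hγp hγq _ _ hE]
    calc _ ≤ ∫⁻ x, (C * D) * V.indicator 1 x ∂muG.bind lamG := by
          refine lintegral_mono fun x => ?_
          rw [weakKernel_apply, Measure.prod_prod, Measure.prod_prod,
            Measure.dirac_apply' _ hVo.measurableSet, mul_assoc, mul_comm (D : ℝ≥0∞)]
          gcongr
          · exact (measure_mono interior_subset).trans (hC _).le
          · exact (measure_mono interior_subset).trans (hD _).le
      _ < ⊤ := by
          rw [lintegral_const_mul' _ _ (by finiteness), lintegral_indicator_one hVo.measurableSet]
          finiteness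

end UnitMeasure

end WeakPullback

/-! ### Induced measures: local finiteness and non-vanishing -/

section Induced

variable {G : Type*} [TopologicalSpace G] [MeasurableSpace G] [ArrowGroupoid G]

theorem isLocallyFiniteMeasure_inducedMeasure [T2Space G] [BorelSpace G] [LocallyCompactSpace G]
    [SecondCountableTopology G] {lam : UnitSpace G → Measure G}
    (h : IsCSM rng lam) (mu : Measure (UnitSpace G)) [IsLocallyFiniteMeasure mu] :
    IsLocallyFiniteMeasure (inducedMeasure lam mu) := by
  refine ⟨fun x => ?_⟩
  obtain ⟨U, hU, C, -, hC⟩ := h.isLocallyBounded x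
  obtain ⟨V, hV, hVo, hVf⟩ := mu.exists_isOpen_measure_lt_top (rng x)
  have hopen : IsOpen (interior U ∩ rng ⁻¹' V) := isOpen_interior.inter (hVo.preimage h.2.1)
  refine ⟨_, hopen.mem_nhds ⟨mem_interior_iff_mem_nhds.2 hU, hV⟩, ?_⟩
  rw [inducedMeasure, Measure.bind_apply hopen.measurableSet h.measurable.aemeasurable]
  calc _ ≤ ∫⁻ u, C * V.indicator 1 u ∂mu := by
        refine lintegral_mono fun u => ?_
        by_cases hu : u ∈ V
        · simpa [hu] using (measure_mono (inter_subset_left.trans interior_subset)).trans (hC u).le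
        · refine (measure_mono_null ?_ (h.1.2 u)).le.trans zero_le
          rintro y ⟨-, hy⟩ rfl
          exact hu hy
    _ < ⊤ := by
        rw [lintegral_const_mul' _ _ (by finiteness), lintegral_indicator_one hVo.measurableSet]
        finiteness

theorem inducedMeasure_ne_zero {lam : UnitSpace G → Measure G} (hm : Measurable lam)
    (hpos : IsPositiveOnOpens rng lam) {mu : Measure (UnitSpace G)} (hmu : mu ≠ 0) :
    inducedMeasure lam mu ≠ 0 := by
  intro h0
  have h1 : ∫⁻ u, lam u univ ∂mu = 0 := by
    rw [← Measure.bind_apply .univ hm.aemeasurable]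
    exact (congrArg (fun m : Measure G => m univ) h0)
  rw [lintegral_eq_zero_iff (f := fun u => lam u univ)
    ((Measure.measurable_coe .univ).comp hm)] at h1
  refine hmu (ae_eq_bot.1 (eventually_false_iff_eq_bot.1 ?_))
  filter_upwards [h1] with u hu
  exact (hpos u univ isOpen_univ ⟨u.1, trivial, Subtype.ext u.2⟩).ne' hu

end Induced

theorem rng_apply {S G : Type*} [ArrowGroupoid S] [ArrowGroupoid G] {p : GpdHom S G} (s : S) :
    rng (p s) = p.onUnits (rng s) := Subtype.ext (p.map_r s).symm

/-! ### Disintegrations along homomorphisms -/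

section Disintegration

variable {S G : Type*} [MeasurableSpace S] [ArrowGroupoid S]
  [MeasurableSpace G] [ArrowGroupoid G] {p : GpdHom S G}

theorem IsDisintegration.eq_bind {X Y : Type*} [MeasurableSpace X] [MeasurableSpace Y] {f : X → Y}
    {γ : Kernel Y X} {μ : Measure X} {ν : Measure Y} (h : IsDisintegration f γ μ ν) :
    μ = ν.bind γ := by
  ext E hE
  rw [h.2 E hE, Measure.bind_apply hE γ.measurable.aemeasurable]

/-- The measures disintegrating the unit space along a homomorphism of Haar groupoids are almost
all non-zero. -/
theorem ae_disintegration_ne_zero {lamS : Kernel (UnitSpace S) S} {muS : Measure (UnitSpace S)}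
    {γ : Kernel (UnitSpace G) (UnitSpace S)} {muG : Measure (UnitSpace G)} {m : Measure G}
    (hS : IsSystemOfMeasures rng lamS) (hγ : IsDisintegration p.onUnits γ muS muG)
    (hp : Measurable p) (hr : Measurable (rng : G → UnitSpace G))
    (hm : m ≪ (inducedMeasure lamS muS).map p) :
    ∀ᵐ x ∂m, γ (rng x) univ ≠ 0 := by
  have hN : MeasurableSet {u | γ u univ = 0} :=
    (γ.measurable_coe .univ) (measurableSet_singleton 0)
  -- Over a base point where `γ` vanishes there is no mass, and over any other the fibre misses this
  -- set.
  have h1 : muS (p.onUnits ⁻¹' {u | γ u univ = 0}) = 0 := by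
    rw [hγ.2 _ (hγ.1.1 hN)]
    refine (lintegral_congr fun u => ?_).trans lintegral_zero
    by_cases hu : γ u univ = 0
    · exact measure_mono_null (subset_univ _) hu
    · refine measure_mono_null ?_ (hγ.1.2 u)
      rintro s hs rfl
      exact hu hs
  have hA : MeasurableSet {x : G | γ (rng x) univ ≠ 0} := hr hN.compl
  refine hm.ae_le ?_
  change ∀ᵐ x ∂_, γ (rng x) univ ≠ 0
  rw [ae_map_iff hp.aemeasurable hA, inducedMeasure]
  refine Measure.ae_comp_of_ae_ae (hp hA) ?_
  filter_upwards [compl_mem_ae_iff.2 h1] with s₀ hs₀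
  filter_upwards [hS.ae_eq s₀] with s hs
  rw [rng_apply, hs]
  exact hs₀

theorem ae_comp_rng_eq {lamS : Kernel (UnitSpace S) S}
    {γ : Kernel (UnitSpace G) (UnitSpace S)} (hS : IsSystemOfMeasures rng lamS)
    (hγ : IsSystemOfMeasures p.onUnits γ) [MeasurableSingletonClass (UnitSpace G)]
    (hr : Measurable (rng : G → UnitSpace G)) (hp : Measurable p) (u : UnitSpace G) :
    ∀ᵐ s ∂(lamS ∘ₖ γ) u, rng (p s) = u := by
  rw [Kernel.comp_apply]
  refine Measure.ae_comp_of_ae_ae ((hr.comp hp) (measurableSet_singleton u)) ?_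
  filter_upwards [hγ.ae_eq u] with s₀ hs₀
  filter_upwards [hS.ae_eq s₀] with s hs
  rw [rng_apply, hs, hs₀]

/-- Associativity of `bind`. It identifies the base measure in the translation argument with the
induced measure of `S`, whose quasi-invariance is known. -/
theorem bind_comp_eq_inducedMeasure {lamS : Kernel (UnitSpace S) S} {muS : Measure (UnitSpace S)}
    {γ : Kernel (UnitSpace G) (UnitSpace S)} {muG : Measure (UnitSpace G)}
    (hγ : IsDisintegration p.onUnits γ muS muG) :
    muG.bind (lamS ∘ₖ γ) = inducedMeasure lamS muS := by
  rw [inducedMeasure, hγ.eq_bind,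
    Measure.bind_bind γ.measurable.aemeasurable lamS.measurable.aemeasurable]
  rfl

end Disintegration

theorem measureEquiv_map_inv {G : Type*} [MeasurableSpace G] [ArrowGroupoid G] {μ : Measure G}
    (hi : Measurable (inv : G → G)) (h : μ.map inv ≪ μ) : MeasureEquiv μ (μ.map inv) := by
  refine ⟨?_, h⟩
  have h2 := h.map hi
  rwa [Measure.map_map hi hi, show (inv ∘ inv : G → G) = id from funext inv_inv,
    Measure.map_id] at h2

namespace WeakPullback

/-- Right multiplication by `q t` is left division by `q t` conjugated by inversion, which is the
form that swaps and translations produce. -/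
theorem mid_eq_ldiv {S G T : Type*} [ArrowGroupoid S] [ArrowGroupoid G] [ArrowGroupoid T]
    {p : GpdHom S G} {q : GpdHom T G} (x : WeakPullback p q) :
    x.mid = inv (ldiv (q x.1.2.2) (inv (ldiv (p x.1.1) x.1.2.1))) := by
  rw [ldiv_of_eq x.2.1.symm, ldiv_of_eq (by rw [r_inv, d_mul, x.2.2]), inv_mul_rev]
  exact mul_congr (inv_inv _).symm (inv_inv _).symm _ _

/-! ### Quasi-invariance and non-vanishing -/

section QuasiInvariance

variable {S G T : Type*}
  [TopologicalSpace S] [SecondCountableTopology S] [T2Space S]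
  [MeasurableSpace S] [BorelSpace S] [ArrowGroupoid S] [IsTopologicalGroupoid S]
  [TopologicalSpace G] [SecondCountableTopology G] [T2Space G]
  [MeasurableSpace G] [BorelSpace G] [ArrowGroupoid G] [IsTopologicalGroupoid G]
  [TopologicalSpace T] [SecondCountableTopology T] [T2Space T]
  [MeasurableSpace T] [BorelSpace T] [ArrowGroupoid T] [IsTopologicalGroupoid T]
  {p : GpdHom S G} {q : GpdHom T G}
  {lamS : Kernel (UnitSpace S) S} {lamG : Kernel (UnitSpace G) G} {lamT : Kernel (UnitSpace T) T}
  {γp : Kernel (UnitSpace G) (UnitSpace S)} [IsSFiniteKernel γp]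
  {γq : Kernel (UnitSpace G) (UnitSpace T)} [IsSFiniteKernel γq]

theorem isQuasiInvariant_unitMeasure [IsSFiniteKernel lamS] [IsSFiniteKernel lamG]
    [IsSFiniteKernel lamT] {muS : Measure (UnitSpace S)} {muG : Measure (UnitSpace G)}
    {muT : Measure (UnitSpace T)} (hp : Continuous p) (hq : Continuous q)
    (hS : IsSystemOfMeasures rng lamS) (hG : IsSystemOfMeasures rng lamG)
    (hT : IsSystemOfMeasures rng lamT) (hG' : IsLeftInvariant lamG)
    (hγp : IsDisintegration p.onUnits γp muS muG) (hγq : IsDisintegration q.onUnits γq muT muG)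
    (hqS : IsQuasiInvariant lamS muS) (hqG : IsQuasiInvariant lamG muG)
    (hqT : IsQuasiInvariant lamT muT) :
    IsQuasiInvariant (haarSystem p q lamS lamT) (unitMeasure p q lamG muG γp γq) := by
  have hr : Measurable (rng : G → UnitSpace G) := continuous_rng.measurable
  have := isTopologicalGroupoid hp hq
  have hi : Measurable (inv : WeakPullback p q → WeakPullback p q) := continuous_inv.measurable
  have hval := measurableEmbedding_val hp hq (p := p) (q := q)
  have hσ := quasiMeasurePreserving_swap (lamS ∘ₖ γp) (lamT ∘ₖ γq) hqG.2
  have hσ' := quasiMeasurePreserving_swap (lamT ∘ₖ γq) (lamS ∘ₖ γp) hqG.2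
  have hα := quasiMeasurePreserving_translate (lamS ∘ₖ γp) (lamT ∘ₖ γq) lamG muG hG hG'
    hp.measurable (ae_comp_rng_eq hS hγp.1 hr hp.measurable) continuous_inv.measurable p.map_inv
    (by rw [bind_comp_eq_inducedMeasure hγp]; exact hqS.2)
  have hβ := quasiMeasurePreserving_translate (lamT ∘ₖ γq) (lamS ∘ₖ γp) lamG muG hG hG'
    hq.measurable (ae_comp_rng_eq hT hγq.1 hr hq.measurable) continuous_inv.measurable q.map_inv
    (by rw [bind_comp_eq_inducedMeasure hγq]; exact hqT.2)
  -- The composite is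
  -- $(s,g,t)\mapsto(s^{-1},p(s)^{-1}g,t)\mapsto(t,g^{-1}p(s),s^{-1})\mapsto(t^{-1},q(t)^{-1}g^{-1}p(s),s^{-1})\mapsto(s^{-1},p(s)^{-1}g\,q(t),t^{-1})$
  -- on $P$.
  have htot := hσ'.comp (hβ.comp (hσ.comp hα))
  refine measureEquiv_map_inv hi (Measure.AbsolutelyContinuous.mk fun E hE h0 => ?_)
  have hE' := hval.measurableSet_image.2 hE
  have hEE : E = Subtype.val ⁻¹' (Subtype.val '' E) :=
    (preimage_image_eq _ Subtype.val_injective).symm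
  rw [hEE, ← Measure.map_apply hval.measurable hE',
    map_val_inducedMeasure hp hq hS hT hγp.1 hγq.1] at h0
  have h1 := htot.preimage_null h0
  change ((muG.bind lamG).bind (weakKernel (lamS ∘ₖ γp) (lamT ∘ₖ γq))) _ = 0 at h1
  rw [← map_val_inducedMeasure hp hq hS hT hγp.1 hγq.1,
    Measure.map_apply hval.measurable (htot.measurable hE')] at h1
  rw [Measure.map_apply hi hE]
  convert h1 using 2
  ext x
  have hx : ((inv x : WeakPullback p q) : S × G × T) =
      (inv x.1.1, inv (ldiv (q x.1.2.2) (inv (ldiv (p x.1.1) x.1.2.1))), inv x.1.2.2) :=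
    Prod.ext rfl (Prod.ext (mid_eq_ldiv x) rfl)
  conv_lhs => rw [hEE]
  simp only [mem_preimage, Function.comp_apply, hx]

/-- The mass of `eta x` is the product of the masses of `γp (rng x)` and `γq (dom x)`. The first is
almost surely non-zero, and so is the second after transport along inversion, which turns `rng` into
`dom`. -/
theorem unitMeasure_ne_zero {muS : Measure (UnitSpace S)} {muG : Measure (UnitSpace G)}
    {muT : Measure (UnitSpace T)} (hp : Continuous p) (hq : Continuous q)
    (hS : IsSystemOfMeasures rng lamS) (hT : IsSystemOfMeasures rng lamT)
    (hγp : IsDisintegration p.onUnits γp muS muG) (hγq : IsDisintegration q.onUnits γq muT muG)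
    (hqG : IsQuasiInvariant lamG muG) (hG0 : inducedMeasure lamG muG ≠ 0)
    (hpm : inducedMeasure lamG muG ≪ (inducedMeasure lamS muS).map p)
    (hqm : inducedMeasure lamG muG ≪ (inducedMeasure lamT muT).map q) :
    unitMeasure p q lamG muG γp γq ≠ 0 := by
  intro h0
  have hr : Measurable (rng : G → UnitSpace G) := continuous_rng.measurable
  have h1 := unitMeasure_apply hp hq hγp.1 hγq.1 lamG muG (E := univ) .univ
  rw [h0, Measure.coe_zero, Pi.zero_apply, eq_comm,
    lintegral_eq_zero_iff (Kernel.measurable_coe _ .univ)] at h1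
  have h2 := ae_disintegration_ne_zero hS hγp hp.measurable hr hpm
  have h3 := ae_disintegration_ne_zero hT hγq hq.measurable hr hqm
  have hi : Measure.QuasiMeasurePreserving (inv : G → G) (inducedMeasure lamG muG)
    (inducedMeasure lamG muG) := ⟨continuous_inv.measurable, hqG.2⟩
  refine hG0 (ae_eq_bot.1 (eventually_false_iff_eq_bot.1 ?_))
  filter_upwards [h1, h2, hi.ae h3] with x hx hx2 hx3
  have e : rng (inv x) = dom x := Subtype.ext (r_inv x)
  rw [e] at hx3
  rw [weakKernel_apply, ← univ_prod_univ, ← univ_prod_univ, Measure.prod_prod, Measure.prod_prod,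
    measure_univ (μ := Measure.dirac x), one_mul] at hx
  exact mul_ne_zero hx2 hx3 hx

end QuasiInvariance

/-- The weak pullback of Haar groupoids is a Haar groupoid. -/
theorem isHaarGroupoid {S G T : Type*}
    [TopologicalSpace S] [MeasurableSpace S] [ArrowGroupoid S]
    [TopologicalSpace G] [MeasurableSpace G] [ArrowGroupoid G]
    [TopologicalSpace T] [MeasurableSpace T] [ArrowGroupoid T]
    (lamS : UnitSpace S → Measure S) (muS : Measure (UnitSpace S))
    (lamG : UnitSpace G → Measure G) (muG : Measure (UnitSpace G))
    (lamT : UnitSpace T → Measure T) (muT : Measure (UnitSpace T))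
    (hS : IsHaarGroupoid lamS muS)
    (hG : IsHaarGroupoid lamG muG)
    (hT : IsHaarGroupoid lamT muT)
    (p : GpdHom S G) (q : GpdHom T G)
    (hp : IsHaarHom lamS muS lamG muG p)
    (hq : IsHaarHom lamT muT lamG muG q)
    (γp : UnitSpace G → Measure (UnitSpace S))
    (γq : UnitSpace G → Measure (UnitSpace T))
    (hγp : IsBSM p.onUnits γp)
    (hγp_dis : IsDisintegration p.onUnits γp muS muG)
    (hγp_bdd : IsLocallyBounded γp)
    (hγq : IsBSM q.onUnits γq)
    (hγq_dis : IsDisintegration q.onUnits γq muT muG)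
    (hγq_bdd : IsLocallyBounded γq) :
    IsHaarGroupoid (haarSystem p q lamS lamT)
      (unitMeasure p q lamG muG γp γq) := by
  have := hS.topologicalGroupoid
  have := hS.locallyCompact
  have := hS.secondCountable
  have := hS.hausdorff
  have := hS.borel
  have := hG.topologicalGroupoid
  have := hG.locallyCompact
  have := hG.secondCountable
  have := hG.hausdorff
  have := hG.borel
  have := hG.radon
  have : LocallyCompactSpace (UnitSpace G) :=
    isClosed_units.isClosedEmbedding_subtypeVal.locallyCompactSpace
  have := hT.topologicalGroupoid
  have := hT.locallyCompact
  have := hT.secondCountable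
  have := hT.hausdorff
  have := hT.borel
  obtain ⟨lamS, rfl⟩ : ∃ κ : Kernel (UnitSpace S) S, ⇑κ = lamS :=
    ⟨⟨lamS, hS.haarSystem.csm.measurable⟩, rfl⟩
  obtain ⟨lamG, rfl⟩ : ∃ κ : Kernel (UnitSpace G) G, ⇑κ = lamG :=
    ⟨⟨lamG, hG.haarSystem.csm.measurable⟩, rfl⟩
  obtain ⟨lamT, rfl⟩ : ∃ κ : Kernel (UnitSpace T) T, ⇑κ = lamT :=
    ⟨⟨lamT, hT.haarSystem.csm.measurable⟩, rfl⟩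
  obtain ⟨γp, rfl⟩ : ∃ κ : Kernel (UnitSpace G) (UnitSpace S), ⇑κ = γp :=
    ⟨⟨γp, Measure.measurable_of_measurable_coe _ hγp.2⟩, rfl⟩
  obtain ⟨γq, rfl⟩ : ∃ κ : Kernel (UnitSpace G) (UnitSpace T), ⇑κ = γq :=
    ⟨⟨γq, Measure.measurable_of_measurable_coe _ hγq.2⟩, rfl⟩
  have := isSFiniteKernel_of_isLocallyBounded lamS hS.haarSystem.csm.isLocallyBounded
  have := isSFiniteKernel_of_isLocallyBounded lamG hG.haarSystem.csm.isLocallyBounded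
  have := isSFiniteKernel_of_isLocallyBounded lamT hT.haarSystem.csm.isLocallyBounded
  have := isSFiniteKernel_of_isLocallyBounded γp hγp_bdd
  have := isSFiniteKernel_of_isLocallyBounded γq hγq_bdd
  have hsS := hS.haarSystem.csm.1
  have hsG := hG.haarSystem.csm.1
  have hsT := hT.haarSystem.csm.1
  have htop := isTopologicalGroupoid hp.1 hq.1
  have hlc : LocallyCompactSpace (WeakPullback p q) :=
    (isClosedEmbedding_val hp.1 hq.1).locallyCompactSpace
  have hsc : SecondCountableTopology (WeakPullback p q) :=
    (isClosedEmbedding_val hp.1 hq.1).isEmbedding.secondCountableTopology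
  have hlc' : LocallyCompactSpace (UnitSpace (WeakPullback p q)) :=
    isClosed_units.isClosedEmbedding_subtypeVal.locallyCompactSpace
  refine ⟨htop, hlc, hsc, inferInstance, inferInstance, ⟨?_, ?_, ?_⟩, ?_, ?_, ?_⟩
  · exact isCSM_haarSystem hsS hsT hp.1 hq.1 hS.haarSystem.csm hT.haarSystem.csm
  · exact isLeftInvariant_haarSystem hsS hsT hp.1 hq.1 hS.haarSystem.left_invariant
      hT.haarSystem.left_invariant
  · exact isPositiveOnOpens_haarSystem hsS hsT hp.1 hq.1 hS.haarSystem.positive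
      hT.haarSystem.positive
  -- On a locally compact second countable Hausdorff space, local finiteness already gives
  -- regularity.
  · have : IsLocallyFiniteMeasure (muG.bind lamG) :=
      isLocallyFiniteMeasure_inducedMeasure hG.haarSystem.csm muG
    have := isLocallyFiniteMeasure_unitMeasure hp.1 hq.1 hγp.1 hγq.1 hγp_bdd hγq_bdd
      lamG muG
    infer_instance
  · exact unitMeasure_ne_zero hp.1 hq.1 hsS hsT hγp_dis hγq_dis hG.quasiInvariant
      (inducedMeasure_ne_zero hG.haarSystem.csm.measurable hG.haarSystem.positive hG.nonzero)
      hp.2.2 hq.2.2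
  · exact isQuasiInvariant_unitMeasure hp.1 hq.1 hsS hsG hsT
      hG.haarSystem.left_invariant hγp_dis hγq_dis hS.quasiInvariant hG.quasiInvariant
      hT.quasiInvariant

end WeakPullback

end HaarGpd

theorem mainTheorem3 {S G T : Type*}
    [TopologicalSpace S] [MeasurableSpace S] [HaarGpd.ArrowGroupoid S]
    [TopologicalSpace G] [MeasurableSpace G] [HaarGpd.ArrowGroupoid G]
    [TopologicalSpace T] [MeasurableSpace T] [HaarGpd.ArrowGroupoid T]
    (lamS : HaarGpd.UnitSpace S → Measure S) (muS : Measure (HaarGpd.UnitSpace S))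
    (lamG : HaarGpd.UnitSpace G → Measure G) (muG : Measure (HaarGpd.UnitSpace G))
    (lamT : HaarGpd.UnitSpace T → Measure T) (muT : Measure (HaarGpd.UnitSpace T))
    (hS : HaarGpd.IsHaarGroupoid lamS muS)
    (hG : HaarGpd.IsHaarGroupoid lamG muG)
    (hT : HaarGpd.IsHaarGroupoid lamT muT)
    (p : HaarGpd.GpdHom S G) (q : HaarGpd.GpdHom T G)
    (hp : HaarGpd.IsHaarHom lamS muS lamG muG p)
    (hq : HaarGpd.IsHaarHom lamT muT lamG muG q)
    (γp : HaarGpd.UnitSpace G → Measure (HaarGpd.UnitSpace S))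
    (γq : HaarGpd.UnitSpace G → Measure (HaarGpd.UnitSpace T))
    (hγp : HaarGpd.IsBSM p.onUnits γp)
    (hγp_dis : HaarGpd.IsDisintegration p.onUnits γp muS muG)
    (hγp_bdd : HaarGpd.IsLocallyBounded γp)
    (hγq : HaarGpd.IsBSM q.onUnits γq)
    (hγq_dis : HaarGpd.IsDisintegration q.onUnits γq muT muG)
    (hγq_bdd : HaarGpd.IsLocallyBounded γq) :
    HaarGpd.IsHaarGroupoid (HaarGpd.WeakPullback.haarSystem p q lamS lamT)
      (HaarGpd.WeakPullback.unitMeasure p q lamG muG γp γq) :=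
  HaarGpd.WeakPullback.isHaarGroupoid lamS muS lamG muG lamT muT hS hG hT p q hp hq γp γq
    hγp hγp_dis hγp_bdd hγq hγq_dis hγq_bdd
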